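/- Let $d\in\mathbb N$ (the case of interest is $d=2,3$), let $\mathcal O\subset\mathbb R^d$ be open, possibly unbounded, let $(\mathcal O_R)_{R\in\mathbb N}$ be an increasing sequence of bounded open sets with $\bigcup_R\mathcal O_R=\mathcal O$, let $T>0$ and let $m>\frac d2+1$ be real. Put $\mathcal V_0=\{v\in C_c^\infty(\mathcal O;\mathbb R^d):\operatorname{div}v=0\}$ and let $H_0$ be the closure of $\mathcal V_0$ in $L^2(\mathcal O;\mathbb R^d)$. For $k\in\mathbb N$ let $H^m(\mathcal O;\mathbb R^k)$ be the space of restrictions to $\mathcal O$ of elements of $H^m(\mathbb R^d;\mathbb R^k)$ with the quotient norm, let $H^m_0(\mathcal O;\mathbb R^k)$ be the closure of $C_c^\infty(\mathcal O;\mathbb R^k)$ in it, $H^{-m}(\mathcal O;\mathbb R^k)$ the dual of $H^m_0(\mathcal O;\mathbb R^k)$, and let $U_m$ be the closure of $\mathcal V_0$ in $H^m(\mathcal O;\mathbb R^d)$. Let $b(u,w,v)=\sum_{i=1}^d\int_{\mathcal O}u_i\,\frac{\partial w}{\partial x_i}\cdot v\,dx$. Convergence $f_n\to f$ in $L^2(0,T;L^2_{loc}(\mathcal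 O))$ means $p_{T,R}(f_n-f)\to0$ for all $R$, where $p_{T,R}(f)=\bigl(\int_0^T\int_{\mathcal O_R}|f(t,x)|^2\,dx\,dt\bigr)^{1/2}$. (i) For every $k$ there is exactly one bounded bilinear map $B:H_0\times L^2(\mathcal O;\mathbb R^k)\to H^{-m}(\mathcal O;\mathbb R^k)$, i.e. $|\langle B(u,w),\varphi\rangle|\le C\|u\|_{L^2}\|w\|_{L^2}\|\varphi\|_{H^m}$ with $C$ independent of $u,w,\varphi$, such that $\langle B(u,w),\varphi\rangle=b(u,w,\varphi)$ for all $u\in H_0\cap H^1(\mathcal O;\mathbb R^d)$, $w\in H^1(\mathcal O;\mathbb R^k)$ and $\varphi\in H^m_0(\mathcal O;\mathbb R^k)$. (ii) Let $u\in L^2(0,T;H_0)$ and let $(u_n)$ be a bounded sequence in $L^2(0,T;H_0)$ with $u_n\to u$ in $L^2(0,T;L^2_{loc}(\mathcal O;\mathbb R^d))$. Let $w\in L^2(0,T;L^2(\mathcal O;\mathbb R^k))$ and let $(w_n)$ be a bounded sequence in $L^2(0,T;L^2(\mathcal O;\mathbb R^k))$ with $w_n\to w$ in $L^2(0,T;L^2_{loc}(\mathcal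 O;\mathbb R^k))$. Then for all $t\in[0,T]$ and all $\varphi\in H^m_0(\mathcal O;\mathbb R^k)$ the functions $s\mapsto\langle B(u_n(s),w_n(s)),\varphi\rangle$ and $s\mapsto\langle B(u(s),w(s)),\varphi\rangle$ are integrable on $[0,T]$ and $$\lim_{n\to\infty}\int_0^t\langle B(u_n(s),w_n(s)),\varphi\rangle\,ds=\int_0^t\langle B(u(s),w(s)),\varphi\rangle\,ds.$$ (iii) For $k=d$ the map $B_0=B|_{H_0\times H_0}$ satisfies condition (B.5): for every $\varphi\in U_m$ the map $u\mapsto\langle B_0(u(\cdot),u(\cdot)),\varphi\rangle$ takes $L^2(0,T;H_0)$ into $L^1(0,T)$, and its restriction to each bounded subset of $L^2(0,T;H_0)$ is continuous into $L^1(0,T)$ when that subset carries the topology induced by $L^2(0,T;L^2_{loc}(\mathcal O;\mathbb R^d))$. -/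

import Mathlib

open Set Filter Topology MeasureTheory
open scoped ENNReal NNReal ContDiff FourierTransform

noncomputable section

namespace Convective

/-- Euclidean space `ℝⁿ`. -/
abbrev E (n : ℕ) := EuclideanSpace ℝ (Fin n)

/-- `L²(O; ℝᵏ)` for `O ⊆ ℝᵈ`, with Lebesgue measure. -/
abbrev L2 {d : ℕ} (O : Set (E d)) (k : ℕ) := Lp (E k) 2 (volume.restrict O)

variable {d k : ℕ}

/-! ### Test functions -/

/-- `f ∈ C_c^∞(O; F)`: `f` is smooth and its support is a compact subset of `O`. -/
structure IsTestFunction {F : Type*} [NormedAddCommGroup F] [NormedSpace ℝ F]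
    (O : Set (E d)) (f : E d → F) : Prop where
  smooth : ContDiff ℝ ∞ f
  compact : HasCompactSupport f
  support : tsupport f ⊆ O

/-- The partial derivative `∂f/∂xᵢ` of a function on `ℝᵈ`. -/
def partialDeriv {F : Type*} [NormedAddCommGroup F] [NormedSpace ℝ F]
    (i : Fin d) (f : E d → F) (x : E d) : F :=
  fderiv ℝ f x (EuclideanSpace.single i 1)

/-- The divergence `∑ᵢ ∂fᵢ/∂xᵢ` of a vector field on `ℝᵈ`. -/
def divergence (f : E d → E d) (x : E d) : ℝ := ∑ i, partialDeriv i f x i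

section TestFunctionLemmas

variable {F : Type*} [NormedAddCommGroup F] [NormedSpace ℝ F] {O : Set (E d)} {f g : E d → F}

theorem IsTestFunction.zero : IsTestFunction O (0 : E d → F) where
  smooth := contDiff_const
  compact := HasCompactSupport.zero
  support := by simp [tsupport]

theorem IsTestFunction.add (hf : IsTestFunction O f) (hg : IsTestFunction O g) :
    IsTestFunction O (f + g) where
  smooth := hf.smooth.add hg.smooth
  compact := hf.compact.add hg.compact
  support := (tsupport_add f g).trans (union_subset hf.support hg.support)

theorem IsTestFunction.smul (c : ℝ) (hf : IsTestFunction O f) : IsTestFunction O (c • f) where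
  smooth := contDiff_const.smul hf.smooth
  compact := hf.compact.smul_left (f := fun _ => c)
  support := (closure_mono (Function.support_const_smul_subset c f)).trans hf.support

theorem IsTestFunction.differentiable (hf : IsTestFunction O f) : Differentiable ℝ f :=
  hf.smooth.differentiable (by simp)

end TestFunctionLemmas

/-- `C_c^∞(O; ℝᵏ)` as a subspace of `L²(O; ℝᵏ)`. -/
def testSpace (O : Set (E d)) (k : ℕ) : Submodule ℝ (L2 O k) where
  carrier := {v | ∃ f : E d → E k, IsTestFunction O f ∧ v =ᵐ[volume.restrict O] f}
  zero_mem' := ⟨0, IsTestFunction.zero, Lp.coeFn_zero _ _ _⟩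
  add_mem' := by
    rintro v w ⟨f, hf, hv⟩ ⟨g, hg, hw⟩
    exact ⟨f + g, hf.add hg, (Lp.coeFn_add v w).trans (hv.add hw)⟩
  smul_mem' := by
    rintro c v ⟨f, hf, hv⟩
    exact ⟨c • f, hf.smul c, (Lp.coeFn_smul c v).trans (hv.const_smul c)⟩

/-- `𝒱₀ = {f ∈ C_c^∞(O; ℝᵈ) : div f = 0}` as a subspace of `L²(O; ℝᵈ)`. -/
def solenoidalTestSpace (O : Set (E d)) : Submodule ℝ (L2 O d) where
  carrier := {v | ∃ f : E d → E d, IsTestFunction O f ∧ (∀ x, divergence f x = 0) ∧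
    v =ᵐ[volume.restrict O] f}
  zero_mem' := by
    refine ⟨0, IsTestFunction.zero, fun x => ?_, Lp.coeFn_zero _ _ _⟩
    simp [divergence, partialDeriv]
  add_mem' := by
    rintro v w ⟨f, hf, hf', hv⟩ ⟨g, hg, hg', hw⟩
    refine ⟨f + g, hf.add hg, fun x => ?_, (Lp.coeFn_add v w).trans (hv.add hw)⟩
    have h1 := hf' x
    have h2 := hg' x
    simp only [divergence, partialDeriv] at h1 h2 ⊢
    rw [fderiv_add (hf.differentiable x) (hg.differentiable x)]
    simp [Finset.sum_add_distrib, h1, h2]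
  smul_mem' := by
    rintro c v ⟨f, hf, hf', hv⟩
    refine ⟨c • f, hf.smul c, fun x => ?_, (Lp.coeFn_smul c v).trans (hv.const_smul c)⟩
    have h1 := hf' x
    simp only [divergence, partialDeriv] at h1 ⊢
    rw [fderiv_const_smul (hf.differentiable x)]
    simp [← Finset.mul_sum, h1]

/-- `H₀`: the closure of `𝒱₀` in `L²(O; ℝᵈ)`, with the `L²` norm. -/
def H₀ (O : Set (E d)) : Submodule ℝ (L2 O d) := (solenoidalTestSpace O).topologicalClosure

/-! ### The spaces `Hᵐ` of real order `m` -/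

/-- The inclusion `ℝᵏ → ℂᵏ`. -/
def complexify (k : ℕ) : E k →L[ℝ] EuclideanSpace ℂ (Fin k) :=
  LinearMap.toContinuousLinearMap
    { toFun := fun x => WithLp.toLp 2 fun j => (x j : ℂ)
      map_add' := fun x y => by ext j; simp
      map_smul' := fun c x => by ext j; simp }

/-- The norm `(∫ (1 + |ξ|²)ᵐ |V̂(ξ)|² dξ)^{1/2}` of `Hᵐ(ℝᵈ; ℝᵏ)`, where `V̂` is the
(Plancherel) Fourier transform; it is `∞` when `V ∈ L²` is not in `Hᵐ(ℝᵈ; ℝᵏ)`. -/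
def wholeSpaceENorm (m : ℝ) (V : Lp (E k) 2 (volume : Measure (E d))) : ℝ≥0∞ :=
  eLpNorm (fun ξ => (1 + ‖ξ‖ ^ 2) ^ (m / 2) • (𝓕 ((complexify k).compLp V) :
    Lp (EuclideanSpace ℂ (Fin k)) 2 (volume : Measure (E d))) ξ) 2 volume

/-- The norm of `Hᵐ(O; ℝᵏ)`, the space of restrictions to `O` of elements of `Hᵐ(ℝᵈ; ℝᵏ)`:
the infimum of the norms of all extensions. It is `∞` when `v` is not in `Hᵐ(O; ℝᵏ)`. -/
def sobolevENorm (m : ℝ) {O : Set (E d)} (v : L2 O k) : ℝ≥0∞ :=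
  ⨅ (V : Lp (E k) 2 (volume : Measure (E d))) (_ : V =ᵐ[volume.restrict O] v), wholeSpaceENorm m V

theorem wholeSpaceENorm_zero (m : ℝ) :
    wholeSpaceENorm m (0 : Lp (E k) 2 (volume : Measure (E d))) = 0 := by
  have h : (complexify k).compLp (0 : Lp (E k) 2 (volume : Measure (E d))) = 0 :=
    ((complexify k).compLpL 2 volume).map_zero
  have h' : (𝓕 ((complexify k).compLp (0 : Lp (E k) 2 (volume : Measure (E d)))) :
      Lp (EuclideanSpace ℂ (Fin k)) 2 (volume : Measure (E d))) = 0 := by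
    rw [h]
    exact (Lp.fourierTransformₗᵢ (E d) (EuclideanSpace ℂ (Fin k))).map_zero
  rw [wholeSpaceENorm, h', ← eLpNorm_zero (p := 2) (μ := (volume : Measure (E d)))
    (α := E d) (ε := EuclideanSpace ℂ (Fin k))]
  refine eLpNorm_congr_ae ?_
  filter_upwards [Lp.coeFn_zero (EuclideanSpace ℂ (Fin k)) 2 (volume : Measure (E d))] with ξ hξ
  rw [hξ]
  simp

theorem measurable_weight (m : ℝ) :
    Measurable fun ξ : E d => ((1 + ‖ξ‖ ^ 2) ^ (m / 2) : ℝ) := by fun_prop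

theorem wholeSpaceENorm_add_le (m : ℝ) (V W : Lp (E k) 2 (volume : Measure (E d))) :
    wholeSpaceENorm m (V + W) ≤ wholeSpaceENorm m V + wholeSpaceENorm m W := by
  have h : (complexify k).compLp (V + W) = (complexify k).compLp V + (complexify k).compLp W :=
    ((complexify k).compLpL 2 volume).map_add V W
  have h' : (𝓕 ((complexify k).compLp (V + W)) :
      Lp (EuclideanSpace ℂ (Fin k)) 2 (volume : Measure (E d))) =
      𝓕 ((complexify k).compLp V) + 𝓕 ((complexify k).compLp W) := by
    rw [h]
    exact (Lp.fourierTransformₗᵢ (E d) (EuclideanSpace ℂ (Fin k))).map_add _ _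
  rw [wholeSpaceENorm, h']
  refine le_trans (le_of_eq (eLpNorm_congr_ae ?_)) (eLpNorm_add_le
    ((measurable_weight m).aestronglyMeasurable.smul (Lp.aestronglyMeasurable _))
    ((measurable_weight m).aestronglyMeasurable.smul (Lp.aestronglyMeasurable _)) one_le_two)
  filter_upwards [Lp.coeFn_add (𝓕 ((complexify k).compLp V) :
      Lp (EuclideanSpace ℂ (Fin k)) 2 (volume : Measure (E d)))
      (𝓕 ((complexify k).compLp W))] with ξ hξ
  rw [hξ, Pi.add_apply, smul_add]
  rfl

theorem wholeSpaceENorm_smul_le (m : ℝ) (c : ℝ) (V : Lp (E k) 2 (volume : Measure (E d))) :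
    wholeSpaceENorm m (c • V) ≤ ‖c‖ₑ * wholeSpaceENorm m V := by
  have h : (complexify k).compLp (c • V) = (c : ℂ) • (complexify k).compLp V := by
    rw [show (complexify k).compLp (c • V) = c • (complexify k).compLp V from
      ((complexify k).compLpL 2 volume).map_smul c V]
    ext1
    filter_upwards [Lp.coeFn_smul c ((complexify k).compLp V),
      Lp.coeFn_smul (c : ℂ) ((complexify k).compLp V)] with x h1 h2
    rw [h1, h2]
    simp
  have h' : (𝓕 ((complexify k).compLp (c • V)) :
      Lp (EuclideanSpace ℂ (Fin k)) 2 (volume : Measure (E d))) =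
      (c : ℂ) • 𝓕 ((complexify k).compLp V) := by
    rw [h]
    exact (Lp.fourierTransformₗᵢ (E d) (EuclideanSpace ℂ (Fin k))).map_smul _ _
  rw [wholeSpaceENorm, h', wholeSpaceENorm]
  refine le_trans (le_of_eq (eLpNorm_congr_ae ?_)) eLpNorm_const_smul_le
  filter_upwards [Lp.coeFn_smul (c : ℂ) (𝓕 ((complexify k).compLp V) :
      Lp (EuclideanSpace ℂ (Fin k)) 2 (volume : Measure (E d)))] with ξ hξ
  rw [hξ]
  simp only [Pi.smul_apply, Complex.coe_smul]
  rw [smul_comm]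

theorem sobolevENorm_zero (m : ℝ) {O : Set (E d)} : sobolevENorm m (0 : L2 O k) = 0 := by
  refine le_antisymm (iInf₂_le_of_le 0 ?_ (wholeSpaceENorm_zero m).le) zero_le
  exact EventuallyEq.trans (ae_restrict_of_ae (Lp.coeFn_zero _ _ _)) (Lp.coeFn_zero _ _ _).symm

theorem sobolevENorm_add_le (m : ℝ) {O : Set (E d)} (v w : L2 O k) :
    sobolevENorm m (v + w) ≤ sobolevENorm m v + sobolevENorm m w := by
  simp only [sobolevENorm]
  refine ENNReal.le_iInf₂_add_iInf₂ fun V hV W hW => ?_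
  refine iInf₂_le_of_le (V + W) ?_ (wholeSpaceENorm_add_le m V W)
  exact EventuallyEq.trans (ae_restrict_of_ae (Lp.coeFn_add V W)) ((hV.add hW).trans (Lp.coeFn_add v w).symm)

theorem sobolevENorm_smul_le (m : ℝ) {O : Set (E d)} (c : ℝ) (v : L2 O k) :
    sobolevENorm m (c • v) ≤ ‖c‖ₑ * sobolevENorm m v := by
  rcases eq_or_ne c 0 with rfl | hc
  · simp [sobolevENorm_zero]
  simp only [sobolevENorm]
  rw [ENNReal.mul_iInf_of_ne (by simpa using hc) (by simp)]
  refine le_iInf fun V => ?_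
  rw [ENNReal.mul_iInf_of_ne (by simpa using hc) (by simp)]
  refine le_iInf fun hV => ?_
  refine iInf₂_le_of_le (c • V) ?_ (wholeSpaceENorm_smul_le m c V)
  exact EventuallyEq.trans (ae_restrict_of_ae (Lp.coeFn_smul c V))
    ((hV.const_smul c).trans (Lp.coeFn_smul c v).symm)

/-- The closure of a subspace `S` in `Hᵐ(O; ℝᵏ)` (for `S` contained in `Hᵐ(O; ℝᵏ)`). -/
def sobolevClosure (m : ℝ) {O : Set (E d)} (S : Submodule ℝ (L2 O k)) :
    Submodule ℝ (L2 O k) where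
  carrier := {v | ∀ ε : ℝ≥0∞, 0 < ε → ∃ f ∈ S, sobolevENorm m (v - f) < ε}
  zero_mem' := fun ε hε => ⟨0, S.zero_mem, by simpa [sobolevENorm_zero] using hε⟩
  add_mem' := by
    intro v w hv hw ε hε
    obtain ⟨f, hf, hf'⟩ := hv (ε / 2) (ENNReal.half_pos hε.ne')
    obtain ⟨g, hg, hg'⟩ := hw (ε / 2) (ENNReal.half_pos hε.ne')
    refine ⟨f + g, S.add_mem hf hg, ?_⟩
    rw [add_sub_add_comm, ← ENNReal.add_halves ε]
    exact (sobolevENorm_add_le m _ _).trans_lt (ENNReal.add_lt_add hf' hg')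
  smul_mem' := by
    intro c v hv ε hε
    rcases eq_or_ne c 0 with rfl | hc
    · exact ⟨0, S.zero_mem, by simpa [sobolevENorm_zero] using hε⟩
    have hc0 : ‖c‖ₑ ≠ 0 := by simpa using hc
    rcases eq_or_ne ε ∞ with rfl | hε'
    · obtain ⟨f, hf, hf'⟩ := hv 1 one_pos
      refine ⟨c • f, S.smul_mem c hf, ?_⟩
      rw [← smul_sub]
      exact (sobolevENorm_smul_le m c _).trans_lt
        (ENNReal.mul_lt_top enorm_lt_top (hf'.trans ENNReal.one_lt_top))
    obtain ⟨f, hf, hf'⟩ := hv (ε / ‖c‖ₑ) (ENNReal.div_pos hε.ne' enorm_ne_top)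
    refine ⟨c • f, S.smul_mem c hf, ?_⟩
    rw [← smul_sub]
    refine (sobolevENorm_smul_le m c _).trans_lt ?_
    rw [mul_comm]
    exact (ENNReal.lt_div_iff_mul_lt (Or.inl hc0) (Or.inl enorm_ne_top)).1 hf'

/-- `Hᵐ₀(O; ℝᵏ)`: the closure of `C_c^∞(O; ℝᵏ)` in `Hᵐ(O; ℝᵏ)`. -/
def Hm₀ (m : ℝ) (O : Set (E d)) (k : ℕ) : Submodule ℝ (L2 O k) := sobolevClosure m (testSpace O k)

/-- `U_m`: the closure of `𝒱₀` in `Hᵐ(O; ℝᵈ)`. -/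
def U (m : ℝ) (O : Set (E d)) : Submodule ℝ (L2 O d) := sobolevClosure m (solenoidalTestSpace O)

/-! ### The form `b` and its extension `B` -/

/-- `G = (G₁, …, G_d)` with `Gᵢ ∈ L²(O; ℝᵏ)` is the weak gradient of `w`, i.e. `Gᵢ = ∂w/∂xᵢ`. -/
def IsWeakGradient {O : Set (E d)} (w : L2 O k) (G : Fin d → L2 O k) : Prop :=
  ∀ i, ∀ η : E d → ℝ, IsTestFunction O η →
    ∫ x in O, partialDeriv i η x • w x = - ∫ x in O, η x • G i x

/-- `w ∈ H¹(O; ℝᵏ)`: `w ∈ L²` has a weak gradient in `L²`. -/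
def MemH1 {O : Set (E d)} (w : L2 O k) : Prop := ∃ G, IsWeakGradient w G

/-- `b(u, w, v) = ∑ᵢ ∫_O uᵢ (∂w/∂xᵢ) · v dx`, where `G` is the gradient of `w`. -/
def formb {O : Set (E d)} (u : L2 O d) (G : Fin d → L2 O k) (v : L2 O k) : ℝ :=
  ∑ i, ∫ x in O, u x i * inner ℝ (G i x) (v x)

/-- `B : H₀ × L²(O; ℝᵏ) → H⁻ᵐ(O; ℝᵏ) = (Hᵐ₀(O; ℝᵏ))'` is a bounded bilinear map which extends
`(u, w) ↦ b(u, w, ·)` from fields `u` of class `H¹` (which in `H₀` automatically are divergence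
free with zero normal trace) and functions `w` of class `H¹`. Here `B u w φ = ⟨B(u, w), φ⟩`. -/
structure IsExtensionOfb (m : ℝ) (O : Set (E d)) (k : ℕ)
    (B : H₀ O →ₗ[ℝ] L2 O k →ₗ[ℝ] Hm₀ m O k →ₗ[ℝ] ℝ) : Prop where
  bounded : ∃ C : ℝ≥0, ∀ u w φ,
    ‖B u w φ‖ₑ ≤ C * ‖u‖ₑ * ‖w‖ₑ * sobolevENorm m (φ : L2 O k)
  extends_b : ∀ (u : H₀ O) (w : L2 O k) (G : Fin d → L2 O k), MemH1 (u : L2 O d) →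
    IsWeakGradient w G → ∀ φ : Hm₀ m O k, B u w φ = formb (u : L2 O d) G (φ : L2 O k)

/-! ### Time-dependent functions -/

/-- Lebesgue measure on `[0, T]`. -/
abbrev timeMeasure (T : ℝ) : Measure ℝ := volume.restrict (Icc 0 T)

/-- `(O_R)` is an increasing sequence of bounded open sets with union `O`. -/
structure IsExhaustion (O : Set (E d)) (OR : ℕ → Set (E d)) : Prop where
  isOpen : ∀ R, IsOpen (OR R)
  bounded : ∀ R, Bornology.IsBounded (OR R)
  mono : ∀ R, OR R ⊆ OR (R + 1)
  iUnion : ⋃ R, OR R = O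

/-- The seminorm `(∫₀ᵀ ∫_K |f(t, x)|² dx dt)^{1/2}` for `K ⊆ O`; with `K = O_R` these are the
seminorms `p_{T,R}` generating the topology of `L²(0, T; L²_loc(O))`. -/
def locSeminorm (T : ℝ) {O : Set (E d)} (K : Set (E d)) (f : ℝ → L2 O k) : ℝ≥0∞ :=
  (∫⁻ t in Icc 0 T, ∫⁻ x in K, ‖f t x‖ₑ ^ 2) ^ (1 / 2 : ℝ)

/-- Continuity of the nonlinearity `B₀ = B` on `H₀ × H₀`: for every `φ ∈ U_m` the map
`u ↦ ⟨B₀(u(·), u(·)), φ⟩`, restricted to bounded subsets of `L²(0, T; H₀)`, is continuous into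
`L¹(0, T)` for the topology that `L²(0, T; L²_loc(O))` induces. As the seminorms `p_{T,R}` increase
with `R`, single ones give neighbourhood bases. -/
def NonlinearityIsContinuous (T m : ℝ) (O : Set (E d)) (OR : ℕ → Set (E d))
    (B : H₀ O →ₗ[ℝ] L2 O d →ₗ[ℝ] Hm₀ m O d →ₗ[ℝ] ℝ) : Prop :=
  ∀ φ : Hm₀ m O d, (φ : L2 O d) ∈ U m O →
    (∀ u : Lp (H₀ O) 2 (timeMeasure T), Integrable (fun s => B (u s) (u s) φ) (timeMeasure T)) ∧
    ∀ (M : ℝ) (u : Lp (H₀ O) 2 (timeMeasure T)), ‖u‖ ≤ M → ∀ ε : ℝ, 0 < ε →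
      ∃ R : ℕ, ∃ δ : ℝ≥0∞, 0 < δ ∧ ∀ v : Lp (H₀ O) 2 (timeMeasure T), ‖v‖ ≤ M →
        locSeminorm T (OR R) (fun s => ((v s - u s : H₀ O) : L2 O d)) < δ →
        ∫ s in Icc 0 T, |B (v s) (v s) φ - B (u s) (u s) φ| < ε

end Convective

end

open Convective

namespace Convective

noncomputable section

open scoped SchwartzMap LineDeriv

/-! For a solenoidal test field `u` and a test function `φ`, integration by parts turns `b(u, w, φ)`
into `-∑ᵢ ∫ uᵢ w · ∂ᵢφ`. This expression needs only `u, w ∈ L²` and `∇φ ∈ L^∞`, so it serves as the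
definition of `B` (`convectiveForm`). The bound on `∇φ` is Sobolev's embedding: by Cauchy-Schwarz,
`∫ (1 + |ξ|²)^{1/2} |φ̂|` is at most the `L²` norm of `(1 + |ξ|²)^{(1-m)/2}`, finite for `m > d/2 +
1`, times the `Hᵐ` norm of `φ` (`exists_sobolev_embedding`, passed to `O` in
`exists_isSobolevEmbedding`).

That `B` extends `b` follows by density, first in `u` (`neg_sum_pairing_eq_of_test`), then in `φ`
(`convectiveForm_isExtensionOfb`). Density of test functions in `H₀` and `L²` also forces uniqueness
(`IsExtensionOfb.unique`), so every extension is given by the explicit formula.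

Local convergence is enough for the limits because `φ` is an `Hᵐ` limit of test functions `ψ`. The
error from replacing `φ` by `ψ` is uniformly small on bounded sets of `u` and `w`. By the formula,
the form at `ψ` sees `u` and `w` only on the support of `ψ`, which lies in some `O_R`. The resulting
uniform `L¹(0, T)` estimate, `IsExtensionOfb.exists_locSeminorm_lt`, gives both the convergence of
the integrals and the continuity of `u ↦ B(u, u)`. -/

/-- The product of square integrable functions is integrable. -/
theorem integrable_smul_of_memLp_two {α 𝕜 G : Type*} [MeasurableSpace α] {μ : Measure α}
    [NormedRing 𝕜] [NormedAddCommGroup G] [MulActionWithZero 𝕜 G] [IsBoundedSMul 𝕜 G]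
    {φ : α → 𝕜} {f : α → G} (hφ : MemLp φ 2 μ) (hf : MemLp f 2 μ) :
    Integrable (fun x => φ x • f x) μ :=
  memLp_one_iff_integrable.1 (hf.smul hφ)

/-! ### Fourier pairings and weighted `L¹` bounds -/

section Fourier

variable {V F : Type*} [NormedAddCommGroup V] [InnerProductSpace ℝ V] [FiniteDimensional ℝ V]
  [MeasurableSpace V] [BorelSpace V] [NormedAddCommGroup F] [InnerProductSpace ℂ F]

/-- The Fourier transform on `L²` is moved to the Schwartz function in a pairing. -/
theorem integral_schwartz_smul_eq_fourier [CompleteSpace F] (g : 𝓢(V, ℂ))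
    (f : Lp F 2 (volume : Measure V)) :
    ∫ x, g x • f x = ∫ ξ, (𝓕⁻ g) ξ • (𝓕 f : Lp F 2 (volume : Measure V)) ξ := by
  have h := congrArg (fun D : 𝓢'(V, F) => D (𝓕⁻ g)) (Lp.fourier_toTemperedDistribution_eq f)
  simpa [TemperedDistribution.fourier_apply] using h

/-- The inverse Fourier transform is self-adjoint. -/
theorem integral_fourierInv_smul_eq [CompleteSpace F] (g : 𝓢(V, ℂ)) {h : V → F}
    (hh : Integrable h) :
    ∫ ξ, (𝓕⁻ g) ξ • h ξ = ∫ x, g x • (𝓕⁻ h) x := by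
  have h1 := VectorFourier.integral_fourierIntegral_smul_eq_flip (L := -innerₗ V)
    (μ := (volume : Measure V)) (ν := (volume : Measure V)) Real.continuous_fourierChar
    (continuous_inner (𝕜 := ℝ) (E := V)).neg g.integrable hh
  have h2 : (-innerₗ V).flip = -innerₗ V := by
    ext x y
    simp [real_inner_comm]
  rw [h2] at h1
  rw [SchwartzMap.fourierInv_coe]
  exact h1

/-- The inverse transform of `∂_v g` is `-2πi ⟨ξ, v⟩` times that of `g`. Moving this multiplier onto
`h` and using self-adjointness shows that `𝓕⁻ h` has the weak derivative `𝓕⁻ (2πi ⟨ξ, v⟩ h)`. -/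
theorem integral_lineDeriv_schwartz_smul [CompleteSpace F] (g : 𝓢(V, ℂ)) (v : V)
    {h : V → F}
    (hh : Integrable fun ξ => (inner ℝ ξ v : ℝ) • h ξ) :
    ∫ ξ, (𝓕⁻ (∂_{v} g)) ξ • h ξ =
      - ∫ x, g x • (𝓕⁻ fun ξ => (2 * Real.pi * Complex.I) • ((inner ℝ ξ v : ℝ) • h ξ)) x := by
  have h1 : Integrable fun ξ => (2 * Real.pi * Complex.I) • ((inner ℝ ξ v : ℝ) • h ξ) :=
    hh.smul (2 * Real.pi * Complex.I)
  rw [← integral_fourierInv_smul_eq g h1, ← integral_neg]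
  congr 1 with ξ
  have : (inner ℝ · v).HasTemperateGrowth := by fun_prop
  rw [SchwartzMap.fourierInv_lineDerivOp_eq]
  simp [SchwartzMap.smulLeftCLM_apply_apply this]
  rw [← Complex.coe_smul, smul_smul, smul_smul]
  congr 1
  ring

theorem norm_fourierInv_le (h : V → F) (x : V) : ‖(𝓕⁻ h) x‖ ≤ ∫ ξ, ‖h ξ‖ :=
  VectorFourier.norm_fourierIntegral_le_integral_norm _ _ _ _ _

theorem continuous_fourierInv {h : V → F} (hh : Integrable h) : Continuous (𝓕⁻ h) :=
  VectorFourier.fourierIntegral_continuous Real.continuous_fourierChar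
    (continuous_inner (𝕜 := ℝ) (E := V)).neg hh

/-- The weight `(1 + |ξ|²)^{(1 - m)/2}` is square integrable for `m > dim / 2 + 1`. -/
theorem eLpNorm_weight_lt_top {m : ℝ} (hm : (Module.finrank ℝ V : ℝ) / 2 + 1 < m) :
    eLpNorm (fun ξ : V => ((1 + ‖ξ‖ ^ 2) ^ ((1 - m) / 2) : ℝ)) 2 volume < ⊤ := by
  rw [eLpNorm_lt_top_iff_lintegral_rpow_enorm_lt_top (by norm_num) (by norm_num)]
  -- The squared weight is `(1 + |ξ|²)^{-r/2}` with `r = 2(m - 1)`, integrable because `r` exceeds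
  -- the dimension.
  refine lt_of_eq_of_lt ?_ (integrable_rpow_neg_one_add_norm_sq (E := V) (μ := volume)
    (r := 2 * (m - 1)) (by linarith)).hasFiniteIntegral
  refine lintegral_congr fun ξ => ?_
  have h0 : (0 : ℝ) ≤ 1 + ‖ξ‖ ^ 2 := by positivity
  rw [ENNReal.toReal_ofNat, ENNReal.rpow_ofNat, ← enorm_pow, ← Real.rpow_natCast,
    ← Real.rpow_mul h0]
  congr 2
  push_cast
  ring

/-- Cauchy-Schwarz with the exponents split as `1/2 = (1 - m)/2 + m/2`. The factor `(1 +
|ξ|²)^{1/2}` on the left pays for one derivative. -/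
theorem eLpNorm_one_le_weight {m : ℝ} {h : V → F} (hh : AEStronglyMeasurable h) :
    eLpNorm (fun ξ => ((1 + ‖ξ‖ ^ 2) ^ (1 / 2 : ℝ) : ℝ) • h ξ) 1 volume ≤
      eLpNorm (fun ξ : V => ((1 + ‖ξ‖ ^ 2) ^ ((1 - m) / 2) : ℝ)) 2 volume *
        eLpNorm (fun ξ => ((1 + ‖ξ‖ ^ 2) ^ (m / 2) : ℝ) • h ξ) 2 volume := by
  have hw (s : ℝ) : Measurable fun ξ : V => ((1 + ‖ξ‖ ^ 2) ^ s : ℝ) := by fun_prop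
  refine le_trans (le_of_eq ?_) (eLpNorm_smul_le_mul_eLpNorm (r := 1)
    ((hw (m / 2)).aestronglyMeasurable.smul hh) (hw ((1 - m) / 2)).aestronglyMeasurable)
  congr 1 with ξ
  have h0 : (0 : ℝ) < 1 + ‖ξ‖ ^ 2 := by positivity
  simp only [Pi.smul_apply', smul_smul]
  rw [← Real.rpow_add h0]
  ring_nf

end Fourier

/-! ### Sobolev's embedding on the whole space -/

variable {d k : ℕ}

/-- The real part `ℂᵏ → ℝᵏ`. -/
def realPart (k : ℕ) : EuclideanSpace ℂ (Fin k) →L[ℝ] E k :=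
  LinearMap.toContinuousLinearMap
    { toFun := fun z => WithLp.toLp 2 fun j => (z j).re
      map_add' := fun x y => by ext j; simp
      map_smul' := fun c x => by ext j; simp }

theorem realPart_smul_complexify (c : ℝ) (x : E k) :
    realPart k ((c : ℂ) • complexify k x) = c • x := by
  ext j
  simp [realPart, complexify]

theorem norm_realPart_le (z : EuclideanSpace ℂ (Fin k)) : ‖realPart k z‖ ≤ ‖z‖ := by
  rw [EuclideanSpace.norm_eq, EuclideanSpace.norm_eq]
  refine Real.sqrt_le_sqrt (Finset.sum_le_sum fun j _ => ?_)
  gcongr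
  exact Complex.abs_re_le_norm (z j)

theorem realPart_ofReal_smul (c : ℝ) (z : EuclideanSpace ℂ (Fin k)) :
    realPart k ((c : ℂ) • z) = c • realPart k z := by
  rw [← map_smul, Complex.coe_smul]

/-- A real test function as a complex Schwartz function. -/
def testToSchwartz {η : E d → ℝ} (hη : IsTestFunction univ η) : 𝓢(E d, ℂ) :=
  (hη.compact.comp_left (g := Complex.ofReal) Complex.ofReal_zero).toSchwartzMap
    (Complex.ofRealCLM.contDiff.comp hη.smooth)

theorem testToSchwartz_apply {η : E d → ℝ} (hη : IsTestFunction univ η) (x : E d) :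
    testToSchwartz hη x = (η x : ℂ) := rfl

theorem lineDeriv_testToSchwartz {η : E d → ℝ} (hη : IsTestFunction univ η) (i : Fin d)
    (x : E d) : (∂_{(EuclideanSpace.single i 1 : E d)} (testToSchwartz hη)) x =
      ((partialDeriv i η x : ℝ) : ℂ) := by
  rw [SchwartzMap.lineDerivOp_apply_eq_fderiv]
  have h : HasFDerivAt (fun y => (η y : ℂ)) (Complex.ofRealCLM.comp (fderiv ℝ η x)) x :=
    Complex.ofRealCLM.hasFDerivAt.comp x (hη.differentiable x).hasFDerivAt
  exact congrArg (fun L => L (EuclideanSpace.single i 1)) h.fderiv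

theorem integral_smul_realPart_fourierInv (g : 𝓢(E d, ℂ)) {η : E d → ℝ} (hg : ∀ x, g x = η x)
    {h : E d → EuclideanSpace ℂ (Fin k)} (hh : Integrable h) :
    ∫ x, η x • realPart k ((𝓕⁻ h) x) = realPart k (∫ x, g x • (𝓕⁻ h) x) := by
  rw [← ContinuousLinearMap.integral_comp_comm]
  · simp_rw [hg, realPart_ofReal_smul]
  · exact g.integrable.smul_bdd (∫ ξ, ‖h ξ‖) (continuous_fourierInv hh).aestronglyMeasurable
      (ae_of_all _ (norm_fourierInv_le h))

/-- A real function is the real part of its complexification, so Plancherel's duality applies to it.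
Comparison with `integral_smul_realPart_fourierInv` then identifies `V` and its derivatives with
inverse transforms of integrable functions. -/
theorem integral_smul_Lp_eq_realPart (g : 𝓢(E d, ℂ)) {η : E d → ℝ} (hg : ∀ x, g x = η x)
    (V : Lp (E k) 2 (volume : Measure (E d))) :
    ∫ x, η x • V x = realPart k (∫ ξ, (𝓕⁻ g) ξ • (𝓕 ((complexify k).compLp V) :
      Lp (EuclideanSpace ℂ (Fin k)) 2 (volume : Measure (E d))) ξ) := by
  rw [← integral_schwartz_smul_eq_fourier, ← ContinuousLinearMap.integral_comp_comm]
  · refine integral_congr_ae ?_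
    filter_upwards [(complexify k).coeFn_compLp V] with x hx
    rw [hx, hg, realPart_smul_complexify]
  · exact integrable_smul_of_memLp_two (g.memLp 2 volume) (Lp.memLp _)

/-- Sobolev's embedding: for `m > d/2 + 1`, the elements of `Hᵐ(ℝᵈ; ℝᵏ)` and their first
derivatives are bounded. -/
theorem exists_sobolev_embedding {m : ℝ} (hm : (d : ℝ) / 2 + 1 < m) (k : ℕ) :
    ∃ C : ℝ≥0, ∀ V : Lp (E k) 2 (volume : Measure (E d)), wholeSpaceENorm m V ≠ ⊤ →
      eLpNorm V ⊤ volume ≤ C * wholeSpaceENorm m V ∧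
      ∀ i : Fin d, ∃ G : E d → E k, Continuous G ∧
        eLpNorm G ⊤ volume ≤ C * wholeSpaceENorm m V ∧
        ∀ η : E d → ℝ, IsTestFunction univ η →
          ∫ x, partialDeriv i η x • V x = - ∫ x, η x • G x := by
  have hK := eLpNorm_weight_lt_top (V := E d) (m := m) (by simpa using hm)
  set K := eLpNorm (fun ξ : E d => ((1 + ‖ξ‖ ^ 2) ^ ((1 - m) / 2) : ℝ)) 2 volume with hKdef
  -- The factor `2π` comes from the multiplier `2πi ξᵢ` of `∂ᵢ`; it is wasted in the bound for `V`
  -- itself.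
  obtain ⟨C, hC⟩ : ∃ C : ℝ≥0, (C : ℝ≥0∞) = ENNReal.ofReal (2 * Real.pi) * K :=
    ⟨_, ENNReal.coe_toNNReal (ENNReal.mul_ne_top ENNReal.ofReal_ne_top hK.ne)⟩
  refine ⟨C, fun V hV => ?_⟩
  set h : E d → EuclideanSpace ℂ (Fin k) := ((𝓕 ((complexify k).compLp V) :
      Lp (EuclideanSpace ℂ (Fin k)) 2 (volume : Measure (E d))) :) with hdef
  have hmeas : AEStronglyMeasurable h := Lp.aestronglyMeasurable _
  have hw : Continuous fun ξ : E d => ((1 + ‖ξ‖ ^ 2) ^ (1 / 2 : ℝ) : ℝ) :=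
    Continuous.rpow_const (by fun_prop) fun ξ => Or.inr (by norm_num)
  have h1 : eLpNorm (fun ξ => ((1 + ‖ξ‖ ^ 2) ^ (1 / 2 : ℝ) : ℝ) • h ξ) 1 volume ≤
      K * wholeSpaceENorm m V := eLpNorm_one_le_weight hmeas
  have hint : Integrable fun ξ => ((1 + ‖ξ‖ ^ 2) ^ (1 / 2 : ℝ) : ℝ) • h ξ := by
    refine memLp_one_iff_integrable.1 ⟨hw.aestronglyMeasurable.smul hmeas, ?_⟩
    exact h1.trans_lt (ENNReal.mul_lt_top hK hV.lt_top)
  have hle (ξ : E d) : 1 ≤ (1 + ‖ξ‖ ^ 2) ^ (1 / 2 : ℝ) :=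
    Real.one_le_rpow (by nlinarith [sq_nonneg ‖ξ‖]) (by norm_num)
  have hle' (ξ : E d) : ‖ξ‖ ≤ (1 + ‖ξ‖ ^ 2) ^ (1 / 2 : ℝ) := by
    rw [← Real.sqrt_eq_rpow]
    exact Real.le_sqrt_of_sq_le (by linarith)
  -- functions dominated by the weighted transform have bounded inverse transforms
  have key (h' : E d → EuclideanSpace ℂ (Fin k)) (hm' : AEStronglyMeasurable h')
      (hb : ∀ ξ, ‖h' ξ‖ ≤ 2 * Real.pi * ‖((1 + ‖ξ‖ ^ 2) ^ (1 / 2 : ℝ) : ℝ) • h ξ‖) :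
      Integrable h' ∧ Continuous (fun x => realPart k ((𝓕⁻ h') x)) ∧
        eLpNorm (fun x => realPart k ((𝓕⁻ h') x)) ⊤ volume ≤ C * wholeSpaceENorm m V := by
    have hi : Integrable h' := (hint.norm.const_mul (2 * Real.pi)).mono' hm' (ae_of_all _ hb)
    refine ⟨hi, (realPart k).continuous.comp (continuous_fourierInv hi), ?_⟩
    refine (eLpNormEssSup_le_of_ae_bound (C := ∫ ξ, ‖h' ξ‖) (ae_of_all _ fun x =>
      (norm_realPart_le _).trans (norm_fourierInv_le h' x))).trans ?_
    rw [ofReal_integral_norm_eq_lintegral_enorm hi, ← eLpNorm_one_eq_lintegral_enorm, hC, mul_assoc]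
    refine (eLpNorm_le_mul_eLpNorm_of_ae_le_mul (ae_of_all _ hb) 1).trans ?_
    gcongr
  have hpi : 1 ≤ 2 * Real.pi := by linarith [Real.pi_gt_three]
  obtain ⟨hi, hc, hb⟩ := key h hmeas fun ξ => by
    rw [norm_smul, Real.norm_of_nonneg (zero_le_one.trans (hle ξ))]
    have := mul_le_mul hpi (hle ξ) zero_le_one (by positivity)
    nlinarith [norm_nonneg (h ξ)]
  constructor
  · refine (eLpNorm_congr_ae ?_).trans_le hb
    -- The Plancherel transform and the integral defining `𝓕⁻ h` are compared through test
    -- functions, where both sides become `∫ 𝓕⁻ η · h`.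
    refine ae_eq_of_integral_contDiff_smul_eq
      ((Lp.memLp V).locallyIntegrable (by norm_num)) hc.locallyIntegrable fun η hη hη' => ?_
    have hη : IsTestFunction univ η := ⟨hη, hη', subset_univ _⟩
    rw [integral_smul_Lp_eq_realPart (testToSchwartz hη) (testToSchwartz_apply hη),
      integral_smul_realPart_fourierInv (testToSchwartz hη) (testToSchwartz_apply hη) hi,
      integral_fourierInv_smul_eq _ hi]
  · intro i
    have hin (ξ : E d) : ‖(inner ℝ ξ (EuclideanSpace.single i 1) : ℝ)‖ ≤ ‖ξ‖ := by
      simpa using norm_inner_le_norm (𝕜 := ℝ) ξ (EuclideanSpace.single i (1 : ℝ))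
    have hwi : Continuous fun ξ : E d => (inner ℝ ξ (EuclideanSpace.single i 1) : ℝ) := by fun_prop
    have hii : Integrable fun ξ => (inner ℝ ξ (EuclideanSpace.single i 1) : ℝ) • h ξ := by
      refine hint.mono (hwi.aestronglyMeasurable.smul hmeas) (ae_of_all _ fun ξ => ?_)
      rw [norm_smul, norm_smul, Real.norm_of_nonneg (zero_le_one.trans (hle ξ))]
      gcongr
      exact (hin ξ).trans (hle' ξ)
    obtain ⟨hi', hc', hb'⟩ := key (fun ξ => (2 * Real.pi * Complex.I) •
      ((inner ℝ ξ (EuclideanSpace.single i 1) : ℝ) • h ξ)) (hii.smul (2 * Real.pi * Complex.I)).1 fun ξ => by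
        rw [norm_smul, norm_smul, norm_smul, Real.norm_of_nonneg (zero_le_one.trans (hle ξ))]
        have : ‖(2 * Real.pi * Complex.I : ℂ)‖ = 2 * Real.pi := by
          simp [abs_of_pos Real.pi_pos]
        rw [this]
        gcongr
        exact (hin ξ).trans (hle' ξ)
    refine ⟨_, hc', hb', fun η hη => ?_⟩
    rw [integral_smul_Lp_eq_realPart _ (lineDeriv_testToSchwartz hη i),
      integral_smul_realPart_fourierInv (testToSchwartz hη) (testToSchwartz_apply hη) hi',
      integral_lineDeriv_schwartz_smul _ _ hii, map_neg]

end

/-! ### Weak derivatives and Sobolev's embedding on `O` -/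

noncomputable section

open scoped SchwartzMap

variable {d k : ℕ} {O : Set (E d)} {m : ℝ}

/-- A Schwartz function belongs to `Hᵐ`. -/
theorem eLpNorm_weight_smul_schwartz_lt_top {F : Type*} [NormedAddCommGroup F]
    [InnerProductSpace ℂ F] (m : ℝ) (f : 𝓢(E d, F)) :
    eLpNorm (fun ξ => ((1 + ‖ξ‖ ^ 2) ^ (m / 2) : ℝ) • f ξ) 2 volume < ⊤ := by
  have hw : (fun ξ : E d => ((1 + ‖ξ‖ ^ 2) ^ (m / 2) : ℝ)).HasTemperateGrowth := by fun_prop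
  have h := ((SchwartzMap.smulLeftCLM F fun ξ : E d => ((1 + ‖ξ‖ ^ 2) ^ (m / 2) : ℝ)) f).memLp 2
    volume
  refine lt_of_eq_of_lt (congrArg (fun g => eLpNorm g 2 volume) ?_) h.2
  ext1 ξ
  exact (SchwartzMap.smulLeftCLM_apply_apply hw _ _).symm

/-- The function `f` on all of `ℝᵈ` is an admissible extension of `v`. It is a Schwartz function,
hence so is its transform, and no polynomial weight spoils square integrability. -/
theorem sobolevENorm_ne_top_of_test {v : L2 O k} {f : E d → E k} (hf : IsTestFunction O f)
    (hv : v =ᵐ[volume.restrict O] f) (m : ℝ) : sobolevENorm m v ≠ ⊤ := by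
  set g : 𝓢(E d, E k) := hf.compact.toSchwartzMap hf.smooth with hg
  set gc : 𝓢(E d, EuclideanSpace ℂ (Fin k)) :=
    (hf.compact.comp_left (g := complexify k) (map_zero _)).toSchwartzMap
      ((complexify k).contDiff.comp hf.smooth) with hgc
  have hV : (complexify k).compLp (g.toLp 2 volume) = gc.toLp 2 volume := by
    ext1
    filter_upwards [(complexify k).coeFn_compLp (g.toLp 2 volume), g.coeFn_toLp 2 volume,
      gc.coeFn_toLp 2 volume] with x h1 h2 h3
    rw [h1, h2, h3]
    rfl
  refine ne_top_of_le_ne_top ?_ (iInf₂_le (g.toLp 2 volume) ?_)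
  · rw [wholeSpaceENorm, hV, SchwartzMap.toLp_fourier_eq]
    refine ((eLpNorm_congr_ae ?_).trans_lt (eLpNorm_weight_smul_schwartz_lt_top m (𝓕 gc))).ne
    filter_upwards [(𝓕 gc).coeFn_toLp 2 volume] with ξ hξ
    rw [hξ]
  · exact EventuallyEq.trans (ae_restrict_of_ae (g.coeFn_toLp 2 volume)) hv.symm

theorem testSpace_le_Hm₀ (m : ℝ) : testSpace O k ≤ Hm₀ m O k := fun v hv ε hε =>
  ⟨v, hv, by rwa [sub_self, sobolevENorm_zero]⟩

/-- Membership in the closure gives a test function at distance less than `1`, and that function has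
finite norm. -/
theorem sobolevENorm_ne_top (φ : Hm₀ m O k) : sobolevENorm m (φ : L2 O k) ≠ ⊤ := by
  obtain ⟨f, ⟨g, hg, hfg⟩, hf⟩ := φ.2 1 one_pos
  have h := sobolevENorm_add_le m ((φ : L2 O k) - f) f
  rw [sub_add_cancel] at h
  exact (h.trans_lt (ENNReal.add_lt_top.2
    ⟨hf.trans ENNReal.one_lt_top, (sobolevENorm_ne_top_of_test hg hfg m).lt_top⟩)).ne

/-- Two locally integrable functions on an open set with the same integrals against test functions
agree. -/
theorem ae_eq_of_integral_test_smul_eq {F : Type*} [NormedAddCommGroup F] [NormedSpace ℝ F]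
    [CompleteSpace F] (hO : IsOpen O) {f g : E d → F}
    (hf : LocallyIntegrable f (volume.restrict O)) (hg : LocallyIntegrable g (volume.restrict O))
    (h : ∀ η : E d → ℝ, IsTestFunction O η → ∫ x in O, η x • f x = ∫ x in O, η x • g x) :
    f =ᵐ[volume.restrict O] g := by
  have hfg := locallyIntegrableOn_of_locallyIntegrable_restrict (hf.sub hg)
  have := hO.ae_eq_zero_of_integral_contDiff_smul_eq_zero hfg fun η h1 h2 h3 => by
    rw [← setIntegral_eq_integral_of_forall_compl_eq_zero (s := O)]
    · have hη : Continuous η := h1.continuous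
      simp only [Pi.sub_apply, smul_sub]
      rw [integral_sub, h η ⟨h1, h2, h3⟩, sub_self]
      · exact hf.integrable_smul_left_of_hasCompactSupport hη h2
      · exact hg.integrable_smul_left_of_hasCompactSupport hη h2
    · intro x hx
      rw [image_eq_zero_of_notMem_tsupport (fun hx' => hx (h3 hx')), zero_smul]
  filter_upwards [(ae_restrict_iff' hO.measurableSet).2 this] with x hx
  exact sub_eq_zero.1 hx

theorem setIntegral_test_smul {F : Type*} [NormedAddCommGroup F] [NormedSpace ℝ F]
    {η : E d → ℝ} (hη : tsupport η ⊆ O) (f : E d → F) :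
    ∫ x in O, η x • f x = ∫ x, η x • f x :=
  setIntegral_eq_integral_of_forall_compl_eq_zero fun x hx => by
    rw [image_eq_zero_of_notMem_tsupport (fun hx' => hx (hη hx')), zero_smul]

theorem tsupport_partialDeriv_subset {F : Type*} [NormedAddCommGroup F] [NormedSpace ℝ F]
    (i : Fin d) (f : E d → F) : tsupport (partialDeriv i f) ⊆ tsupport f :=
  closure_minimal ((Function.support_subset_iff'.2 fun x hx => by
    rw [partialDeriv, fderiv_of_notMem_tsupport (𝕜 := ℝ) hx]; rfl)) (isClosed_tsupport f)

theorem IsTestFunction.partialDeriv {F : Type*} [NormedAddCommGroup F] [NormedSpace ℝ F]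
    {f : E d → F} (hf : IsTestFunction O f) (i : Fin d) :
    IsTestFunction O (partialDeriv i f) where
  smooth := (hf.smooth.fderiv_right (m := ∞) (by simp)).clm_apply contDiff_const
  compact := hf.compact.mono' ((subset_tsupport _).trans (tsupport_partialDeriv_subset i f))
  support := (tsupport_partialDeriv_subset i f).trans hf.support

theorem IsTestFunction.mono {F : Type*} [NormedAddCommGroup F] [NormedSpace ℝ F]
    {O' : Set (E d)} {f : E d → F} (hf : IsTestFunction O f) (h : O ⊆ O') : IsTestFunction O' f :=
  ⟨hf.smooth, hf.compact, hf.support.trans h⟩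

/-- `g` is a weak partial derivative of `f` on `O`. -/
def IsWeakPartialDeriv (O : Set (E d)) (i : Fin d) (f g : E d → E k) : Prop :=
  ∀ η : E d → ℝ, IsTestFunction O η →
    ∫ x in O, partialDeriv i η x • f x = - ∫ x in O, η x • g x

/-- Uniqueness of weak derivatives. It makes the derivative independent of the chosen extension,
linear in `φ`, and equal to the classical one on test functions. -/
theorem IsWeakPartialDeriv.ae_eq (hO : IsOpen O) {i : Fin d} {f f' g g' : E d → E k}
    (hf : f =ᵐ[volume.restrict O] f')
    (hg : LocallyIntegrable g (volume.restrict O)) (hg' : LocallyIntegrable g' (volume.restrict O))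
    (h : IsWeakPartialDeriv O i f g) (h' : IsWeakPartialDeriv O i f' g') :
    g =ᵐ[volume.restrict O] g' := by
  refine ae_eq_of_integral_test_smul_eq hO hg hg' fun η hη => ?_
  rw [← neg_inj, ← h η hη, ← h' η hη]
  refine integral_congr_ae ?_
  filter_upwards [hf] with x hx
  rw [hx]

theorem IsWeakPartialDeriv.congr {i : Fin d} {f f' g g' : E d → E k}
    (h : IsWeakPartialDeriv O i f g) (hf : f =ᵐ[volume.restrict O] f')
    (hg : g =ᵐ[volume.restrict O] g') : IsWeakPartialDeriv O i f' g' := by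
  intro η hη
  rw [← integral_congr_ae (hf.mono fun x hx => congrArg (partialDeriv i η x • ·) hx), h η hη,
    ← integral_congr_ae (hg.mono fun x hx => congrArg (η x • ·) hx)]

theorem locallyIntegrable_Lp {p : ℝ≥0∞} (hp : 1 ≤ p) (g : Lp (E k) p (volume.restrict O)) :
    LocallyIntegrable g (volume.restrict O) := (Lp.memLp g).locallyIntegrable hp

/-- For `m > d/2 + 1`, the elements of `Hᵐ(O; ℝᵏ)` and their first derivatives are bounded. -/
theorem exists_sobolev_embedding_on (hO : IsOpen O) (hm : (d : ℝ) / 2 + 1 < m) (k : ℕ) :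
    ∃ C : ℝ≥0, ∀ v : L2 O k, sobolevENorm m v ≠ ⊤ →
      eLpNorm v ⊤ (volume.restrict O) ≤ C * sobolevENorm m v ∧
      ∀ i : Fin d, ∃ G : Lp (E k) ⊤ (volume.restrict O),
        ‖G‖ₑ ≤ C * sobolevENorm m v ∧ IsWeakPartialDeriv O i v G := by
  obtain ⟨C, hC⟩ := exists_sobolev_embedding hm k
  refine ⟨C, fun v hv => ?_⟩
  -- bounds valid for all extensions of finite norm pass to the infimum
  have key {a : ℝ≥0∞} (h : ∀ V : Lp (E k) 2 (volume : Measure (E d)),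
      V =ᵐ[volume.restrict O] v → wholeSpaceENorm m V ≠ ⊤ → a ≤ C * wholeSpaceENorm m V) :
      a ≤ C * sobolevENorm m v := by
    -- For `C = 0` the constant does not pass through an infimum that may include `⊤`; a single
    -- extension of finite norm already gives `a ≤ 0`.
    rcases eq_or_ne C 0 with rfl | hC0
    · obtain ⟨V, hV, hV'⟩ : ∃ V : Lp (E k) 2 (volume : Measure (E d)),
          V =ᵐ[volume.restrict O] v ∧ wholeSpaceENorm m V ≠ ⊤ := by
        by_contra! hcon
        exact hv (by simpa [sobolevENorm] using hcon)
      simpa using h V hV hV'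
    · simp only [sobolevENorm]
      rw [ENNReal.mul_iInf_of_ne (by simpa using hC0) (by simp)]
      refine le_iInf fun V => ?_
      rw [ENNReal.mul_iInf_of_ne (by simpa using hC0) (by simp)]
      refine le_iInf fun hV => ?_
      rcases eq_or_ne (wholeSpaceENorm m V) ⊤ with h1 | h1
      · rw [h1, ENNReal.mul_top (by simpa using hC0)]
        exact le_top
      · exact h V hV h1
  have deriv (V : Lp (E k) 2 (volume : Measure (E d))) (hV : V =ᵐ[volume.restrict O] v)
      (hV' : wholeSpaceENorm m V ≠ ⊤) (i : Fin d) : ∃ G : Lp (E k) ⊤ (volume.restrict O),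
        ‖G‖ₑ ≤ C * wholeSpaceENorm m V ∧ IsWeakPartialDeriv O i v G := by
    obtain ⟨G, hGc, hGb, hG⟩ := (hC V hV').2 i
    have hle : eLpNorm G ⊤ (volume.restrict O) ≤ C * wholeSpaceENorm m V :=
      (eLpNorm_mono_measure _ Measure.restrict_le_self).trans hGb
    have hmem : MemLp G ⊤ (volume.restrict O) := ⟨hGc.aestronglyMeasurable,
      hle.trans_lt (ENNReal.mul_lt_top ENNReal.coe_lt_top hV'.lt_top)⟩
    refine ⟨hmem.toLp G, by rwa [Lp.enorm_toLp], ?_⟩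
    refine IsWeakPartialDeriv.congr (f := V) (g := G) (fun η hη => ?_) hV hmem.coeFn_toLp.symm
    rw [setIntegral_test_smul ((tsupport_partialDeriv_subset i η).trans hη.support),
      setIntegral_test_smul hη.support]
    exact hG η (hη.mono (subset_univ O))
  refine ⟨key fun V hV hV' => ?_, fun i => ?_⟩
  · rw [← eLpNorm_congr_ae hV]
    exact (eLpNorm_mono_measure _ Measure.restrict_le_self).trans (hC V hV').1
  · obtain ⟨V, hV, hV'⟩ : ∃ V : Lp (E k) 2 (volume : Measure (E d)),
        V =ᵐ[volume.restrict O] v ∧ wholeSpaceENorm m V ≠ ⊤ := by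
      by_contra! hcon
      exact hv (by simpa [sobolevENorm] using hcon)
    -- By uniqueness this `G` is the derivative obtained from every other extension, so all their
    -- bounds hold for it and the infimum can be taken.
    obtain ⟨G, -, hG⟩ := deriv V hV hV' i
    refine ⟨G, key fun W hW hW' => ?_, hG⟩
    obtain ⟨G', hb, hG'⟩ := deriv W hW hW' i
    have : G = G' := Lp.ext (hG.ae_eq hO (EventuallyEq.refl _ _)
      (locallyIntegrable_Lp le_top G) (locallyIntegrable_Lp le_top G') hG')
    rwa [this]

theorem IsWeakPartialDeriv.add {i : Fin d} {f f' g g' : E d → E k}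
    (hf : LocallyIntegrable f (volume.restrict O)) (hf' : LocallyIntegrable f' (volume.restrict O))
    (hg : LocallyIntegrable g (volume.restrict O)) (hg' : LocallyIntegrable g' (volume.restrict O))
    (h : IsWeakPartialDeriv O i f g) (h' : IsWeakPartialDeriv O i f' g') :
    IsWeakPartialDeriv O i (f + f') (g + g') := by
  intro η hη
  have h1 := (hη.partialDeriv i).smooth.continuous
  have h2 := (hη.partialDeriv i).compact
  have h3 := hη.smooth.continuous
  simp only [Pi.add_apply, smul_add]
  rw [integral_add (hf.integrable_smul_left_of_hasCompactSupport h1 h2)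
      (hf'.integrable_smul_left_of_hasCompactSupport h1 h2),
    integral_add (hg.integrable_smul_left_of_hasCompactSupport h3 hη.compact)
      (hg'.integrable_smul_left_of_hasCompactSupport h3 hη.compact), h η hη, h' η hη, neg_add]

theorem IsWeakPartialDeriv.const_smul {i : Fin d} {f g : E d → E k}
    (h : IsWeakPartialDeriv O i f g) (c : ℝ) : IsWeakPartialDeriv O i (c • f) (c • g) := by
  intro η hη
  simp only [Pi.smul_apply, smul_comm _ c]
  rw [integral_smul, integral_smul, h η hη, smul_neg]

/-- The inclusion and the first derivatives as bounded operators `Hᵐ₀(O; ℝᵏ) → L^∞(O; ℝᵏ)`. -/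
structure IsSobolevEmbedding (P : Hm₀ m O k →ₗ[ℝ] Lp (E k) ⊤ (volume.restrict O))
    (D : Fin d → Hm₀ m O k →ₗ[ℝ] Lp (E k) ⊤ (volume.restrict O)) (C : ℝ≥0) : Prop where
  bound : ∀ φ : Hm₀ m O k, ‖P φ‖ₑ ≤ C * sobolevENorm m (φ : L2 O k)
  bound_deriv : ∀ (i : Fin d) (φ : Hm₀ m O k), ‖D i φ‖ₑ ≤ C * sobolevENorm m (φ : L2 O k)
  coe_ae : ∀ φ : Hm₀ m O k, P φ =ᵐ[volume.restrict O] (φ : L2 O k)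
  deriv : ∀ (i : Fin d) (φ : Hm₀ m O k), IsWeakPartialDeriv O i (φ : L2 O k) (D i φ)

/-- The derivatives are picked by choice for each `φ`; their linearity comes from uniqueness, since
sums and multiples of weak derivatives are weak derivatives of the sums and multiples. -/
theorem exists_isSobolevEmbedding (hO : IsOpen O) (hm : (d : ℝ) / 2 + 1 < m) (k : ℕ) :
    ∃ (P : Hm₀ m O k →ₗ[ℝ] Lp (E k) ⊤ (volume.restrict O))
      (D : Fin d → Hm₀ m O k →ₗ[ℝ] Lp (E k) ⊤ (volume.restrict O)) (C : ℝ≥0),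
      IsSobolevEmbedding P D C := by
  obtain ⟨C, hC⟩ := exists_sobolev_embedding_on hO hm k
  have hmem (φ : Hm₀ m O k) : MemLp (φ : L2 O k) ⊤ (volume.restrict O) :=
    ⟨Lp.aestronglyMeasurable _, (hC φ (sobolevENorm_ne_top φ)).1.trans_lt
      (ENNReal.mul_lt_top ENNReal.coe_lt_top (sobolevENorm_ne_top φ).lt_top)⟩
  choose G hGb hG using fun (φ : Hm₀ m O k) => (hC φ (sobolevENorm_ne_top φ)).2
  have uniq {i : Fin d} {φ : L2 O k} {g g' : Lp (E k) ⊤ (volume.restrict O)}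
      (h : IsWeakPartialDeriv O i φ g) (h' : IsWeakPartialDeriv O i φ g') : g = g' :=
    Lp.ext (h.ae_eq hO (EventuallyEq.refl _ _) (locallyIntegrable_Lp le_top _)
      (locallyIntegrable_Lp le_top _) h')
  have hloc (φ : L2 O k) : LocallyIntegrable φ (volume.restrict O) :=
    locallyIntegrable_Lp one_le_two φ
  have hloc' (g : Lp (E k) ⊤ (volume.restrict O)) : LocallyIntegrable g (volume.restrict O) :=
    locallyIntegrable_Lp le_top g
  refine ⟨
    { toFun := fun φ => (hmem φ).toLp
      map_add' := fun φ ψ => ?_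
      map_smul' := fun c φ => ?_ }, fun i =>
    { toFun := fun φ => G φ i
      map_add' := fun φ ψ => ?_
      map_smul' := fun c φ => ?_ }, C, ⟨fun φ => ?_, fun i φ => hGb φ i,
        fun φ => (hmem φ).coeFn_toLp, fun i φ => hG φ i⟩⟩
  · rw [← MemLp.toLp_add]
    exact MemLp.toLp_congr _ _ (Lp.coeFn_add _ _)
  · rw [RingHom.id_apply, ← MemLp.toLp_const_smul]
    exact MemLp.toLp_congr _ _ (Lp.coeFn_smul _ _)
  · refine uniq (hG _ i) ?_
    exact ((hG φ i).add (hloc _) (hloc _) (hloc' _) (hloc' _) (hG ψ i)).congr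
      (Lp.coeFn_add _ _).symm (Lp.coeFn_add _ _).symm
  · refine uniq (hG _ i) ?_
    exact ((hG φ i).const_smul c).congr (Lp.coeFn_smul _ _).symm (Lp.coeFn_smul _ _).symm
  · change ‖(hmem φ).toLp‖ₑ ≤ _
    rw [Lp.enorm_toLp]
    exact (hC φ (sobolevENorm_ne_top φ)).1

end

noncomputable section

variable {d k : ℕ} {O : Set (E d)} {m : ℝ}

/-! ### Test functions in `L²` -/

theorem IsTestFunction.memLp {F : Type*} [NormedAddCommGroup F] [NormedSpace ℝ F] {f : E d → F}
    (hf : IsTestFunction O f) (p : ℝ≥0∞) : MemLp f p (volume.restrict O) :=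
  hf.smooth.continuous.memLp_of_hasCompactSupport hf.compact

theorem IsTestFunction.component {f : E d → E k} (hf : IsTestFunction O f) (j : Fin k) :
    IsTestFunction O fun x => f x j where
  smooth := (EuclideanSpace.proj (𝕜 := ℝ) j).contDiff.comp hf.smooth
  compact := hf.compact.comp_left (g := fun y : E k => y j) rfl
  support := (closure_mono (Function.support_subset_iff'.2 fun x hx => by
    simp [Function.notMem_support.1 hx])).trans hf.support

theorem IsTestFunction.smul_fun {F : Type*} [NormedAddCommGroup F] [NormedSpace ℝ F]
    {η : E d → ℝ} {f : E d → F} (hη : IsTestFunction O η) (hf : IsTestFunction O f) :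
    IsTestFunction O fun x => η x • f x where
  smooth := hη.smooth.smul hf.smooth
  compact := hη.compact.smul_right
  support := (tsupport_smul_subset_left η f).trans hη.support

theorem partialDeriv_component {f : E d → E k} (hf : IsTestFunction O f) (i : Fin d) (j : Fin k)
    (x : E d) : partialDeriv i (fun y => f y j) x = partialDeriv i f x j := by
  have h : HasFDerivAt (fun y => f y j)
      ((EuclideanSpace.proj (𝕜 := ℝ) j).comp (fderiv ℝ f x)) x :=
    (EuclideanSpace.proj (𝕜 := ℝ) j).hasFDerivAt.comp x (hf.differentiable x).hasFDerivAt
  exact congrArg (fun L => L (EuclideanSpace.single i 1)) h.fderiv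

theorem partialDeriv_smul {η : E d → ℝ} {f : E d → E k} (hη : IsTestFunction O η)
    (hf : IsTestFunction O f) (i : Fin d) (x : E d) :
    partialDeriv i (fun y => η y • f y) x =
      partialDeriv i η x • f x + η x • partialDeriv i f x := by
  rw [partialDeriv, fderiv_fun_smul (hη.differentiable x) (hf.differentiable x)]
  simp [partialDeriv, add_comm]

/-- The classical partial derivative of a test function is a weak one. -/
theorem IsTestFunction.isWeakPartialDeriv {f : E d → E k} (hf : IsTestFunction O f) (i : Fin d) :
    IsWeakPartialDeriv O i f (Convective.partialDeriv i f) := by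
  intro η hη
  rw [setIntegral_test_smul ((tsupport_partialDeriv_subset i η).trans hη.support),
    setIntegral_test_smul hη.support]
  have h {a : E d → ℝ} {b : E d → E k} (ha : IsTestFunction O a) (hb : IsTestFunction O b) :
      Integrable fun x => a x • b x :=
    (ha.smooth.continuous.smul hb.smooth.continuous).integrable_of_hasCompactSupport
      ha.compact.smul_right
  rw [eq_neg_iff_add_eq_zero, add_comm, ← eq_neg_iff_add_eq_zero]
  exact integral_smul_fderiv_eq_neg_fderiv_smul_of_integrable (h (hη.partialDeriv i) hf)
    (h hη (hf.partialDeriv i)) (h hη hf) (fun x _ => hη.differentiable x)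
    (fun x _ => hf.differentiable x)

theorem memH1_of_test {v : L2 O k} {f : E d → E k} (hf : IsTestFunction O f)
    (hv : v =ᵐ[volume.restrict O] f) :
    ∃ G, IsWeakGradient v G := by
  refine ⟨fun i => ((hf.partialDeriv i).memLp 2).toLp, fun i => ?_⟩
  exact (hf.isWeakPartialDeriv i).congr hv.symm ((hf.partialDeriv i).memLp 2).coeFn_toLp.symm

theorem integral_apply {α : Type*} [MeasurableSpace α] {μ : Measure α} {f : α → E k}
    (hf : Integrable f μ) (j : Fin k) : (∫ x, f x ∂μ) j = ∫ x, f x j ∂μ :=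
  ((EuclideanSpace.proj (𝕜 := ℝ) j).integral_comp_comm hf).symm

theorem IsTestFunction.integrable_smul {F : Type*} [NormedAddCommGroup F] [NormedSpace ℝ F]
    {η : E d → ℝ} (hη : IsTestFunction O η) {f : E d → F}
    (hf : LocallyIntegrable f (volume.restrict O)) :
    Integrable (fun x => η x • f x) (volume.restrict O) :=
  hf.integrable_smul_left_of_hasCompactSupport hη.smooth.continuous hη.compact

theorem IsTestFunction.integrable_component_mul {ζ : E d → E k} (hζ : IsTestFunction O ζ)
    {w : E d → E k} (hw : LocallyIntegrable w (volume.restrict O)) (j : Fin k) :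
    Integrable (fun x => ζ x j * w x j) (volume.restrict O) :=
  (EuclideanSpace.proj (𝕜 := ℝ) j).integrable_comp ((hζ.component j).integrable_smul hw)

theorem IsTestFunction.integrable_inner {ζ : E d → E k} (hζ : IsTestFunction O ζ)
    {w : E d → E k} (hw : LocallyIntegrable w (volume.restrict O)) :
    Integrable (fun x => (inner ℝ (ζ x) (w x) : ℝ)) (volume.restrict O) := by
  simp only [PiLp.inner_apply, RCLike.inner_apply, conj_trivial]
  exact integrable_finsetSum _ fun j _ => by
    simpa only [mul_comm] using hζ.integrable_component_mul hw j

theorem IsTestFunction.integral_inner_eq_sum {ζ : E d → E k} (hζ : IsTestFunction O ζ)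
    {w : E d → E k} (hw : LocallyIntegrable w (volume.restrict O)) :
    ∫ x in O, (inner ℝ (ζ x) (w x) : ℝ) = ∑ j, (∫ x in O, ζ x j • w x) j := by
  simp only [PiLp.inner_apply, RCLike.inner_apply, conj_trivial]
  rw [integral_finsetSum _ fun j _ => by
    simpa only [mul_comm] using hζ.integrable_component_mul hw j]
  refine Finset.sum_congr rfl fun j _ => ?_
  rw [integral_apply ((hζ.component j).integrable_smul hw)]
  simp [mul_comm]

/-- A weak derivative can be tested against vector-valued test functions. -/
theorem IsWeakPartialDeriv.integral_inner {i : Fin d} {w g : E d → E k}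
    (hw : LocallyIntegrable w (volume.restrict O)) (hg : LocallyIntegrable g (volume.restrict O))
    (h : IsWeakPartialDeriv O i w g) {ζ : E d → E k} (hζ : IsTestFunction O ζ) :
    ∫ x in O, (inner ℝ (partialDeriv i ζ x) (w x) : ℝ) = - ∫ x in O, (inner ℝ (ζ x) (g x) : ℝ) := by
  rw [(hζ.partialDeriv i).integral_inner_eq_sum hw, hζ.integral_inner_eq_sum hg,
    ← Finset.sum_neg_distrib]
  refine Finset.sum_congr rfl fun j _ => ?_
  have := h _ (hζ.component j)
  simp only [partialDeriv_component hζ] at this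
  rw [this]
  simp

/-- Integration by parts against a solenoidal test field. -/
theorem sum_integral_solenoidal {f : E d → E d} (hf : IsTestFunction O f)
    (hdiv : ∀ x, divergence f x = 0) {w : E d → E k} {G : Fin d → E d → E k}
    (hw : LocallyIntegrable w (volume.restrict O))
    (hG : ∀ i, LocallyIntegrable (G i) (volume.restrict O))
    (h : ∀ i, IsWeakPartialDeriv O i w (G i)) {g : E d → E k} (hg : IsTestFunction O g) :
    ∑ i, ∫ x in O, f x i * (inner ℝ (G i x) (g x) : ℝ) =
      - ∑ i, ∫ x in O, f x i * (inner ℝ (w x) (partialDeriv i g x) : ℝ) := by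
  have h1 (i : Fin d) : ∫ x in O, f x i * (inner ℝ (G i x) (g x) : ℝ) =
      - (∫ x in O, partialDeriv i f x i * (inner ℝ (g x) (w x) : ℝ)) -
        ∫ x in O, f x i * (inner ℝ (w x) (partialDeriv i g x) : ℝ) := by
    -- The weak derivative is tested against `fᵢ g`, and the product rule yields one term with
    -- `∂ᵢfᵢ` and one with `∂ᵢg`.
    have h2 := (h i).integral_inner hw (hG i) ((hf.component i).smul_fun hg)
    have hi1 := ((hf.partialDeriv i).component i).smul_fun hg |>.integrable_inner hw
    have hi2 := ((hf.component i).smul_fun (hg.partialDeriv i)).integrable_inner hw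
    simp only [partialDeriv_smul (hf.component i) hg, partialDeriv_component hf, inner_add_left,
      real_inner_smul_left] at h2 hi1 hi2
    rw [integral_add hi1 hi2] at h2
    simp only [real_inner_comm (g _) (G i _), real_inner_comm (partialDeriv i g _) (w _)] at h2 ⊢
    linarith
  -- Summed over `i`, the terms with `∂ᵢfᵢ` assemble into the divergence of `f`.
  have h3 : ∑ i, ∫ x in O, partialDeriv i f x i * (inner ℝ (g x) (w x) : ℝ) = 0 := by
    rw [← integral_finsetSum]
    · simp_rw [← Finset.sum_mul]
      refine integral_eq_zero_of_ae (ae_of_all _ fun x => ?_)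
      change divergence f x * _ = 0
      rw [hdiv x, zero_mul]
    · intro i _
      simpa only [real_inner_smul_left] using
        (((hf.partialDeriv i).component i).smul_fun hg).integrable_inner hw
  simp_rw [h1]
  rw [Finset.sum_sub_distrib, Finset.sum_neg_distrib, h3, neg_zero, zero_sub]

/-- An element orthogonal to all `η eⱼ`, with `η` a scalar test function, has all components zero by
the fundamental lemma of the calculus of variations. -/
theorem dense_testSpace (hO : IsOpen O) (k : ℕ) : Dense (testSpace O k : Set (L2 O k)) := by
  rw [Submodule.dense_iff_topologicalClosure_eq_top, Submodule.topologicalClosure_eq_top_iff,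
    Submodule.eq_bot_iff]
  intro v hv
  refine Lp.eq_zero_iff_ae_eq_zero.2 ?_
  refine ae_eq_of_integral_test_smul_eq hO (locallyIntegrable_Lp one_le_two v)
    (locallyIntegrable_const 0) fun η hη => ?_
  simp only [Pi.zero_apply, smul_zero, integral_zero]
  ext j
  have hζ : IsTestFunction O fun x => η x • (EuclideanSpace.single j 1 : E k) :=
    ⟨hη.smooth.smul contDiff_const, hη.compact.smul_right,
      (tsupport_smul_subset_left η _).trans hη.support⟩
  have h := (Submodule.mem_orthogonal _ _).1 hv ((hζ.memLp 2).toLp)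
    ⟨_, hζ, (hζ.memLp 2).coeFn_toLp⟩
  rw [MeasureTheory.L2.inner_def] at h
  rw [integral_apply (hη.integrable_smul (locallyIntegrable_Lp one_le_two v)), PiLp.zero_apply, ← h]
  refine integral_congr_ae ?_
  filter_upwards [(hζ.memLp 2).coeFn_toLp] with x hx
  rw [hx, real_inner_smul_left, EuclideanSpace.inner_single_left]
  simp

end

noncomputable section

variable {d k : ℕ} {O : Set (E d)} {m : ℝ}

/-! ### The trilinear form -/

/-- `(u, w, g) ↦ ∫_O uᵢ w · g dx` on `L² × L² × L^∞`. -/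
def pairing (O : Set (E d)) (k : ℕ) (i : Fin d) :
    L2 O d →L[ℝ] L2 O k →L[ℝ] Lp (E k) ⊤ (volume.restrict O) →L[ℝ] ℝ :=
  -- Hölder's product `L² × L^∞ → L²` is composed with the `L² × L²` pairing, which gives continuity
  -- in all three arguments at once.
  ((ContinuousLinearMap.compL ℝ (L2 O k) (Lp (E k) ⊤ (volume.restrict O) →L[ℝ]
      Lp ℝ 2 (volume.restrict O)) (Lp (E k) ⊤ (volume.restrict O) →L[ℝ] ℝ)).flip
    ((innerSL ℝ).holderL (volume.restrict O) 2 ⊤ 2)).comp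
  ((ContinuousLinearMap.compL ℝ (Lp (E k) ⊤ (volume.restrict O)) (Lp ℝ 2 (volume.restrict O)) ℝ).comp
    (((ContinuousLinearMap.mul ℝ ℝ).comp (EuclideanSpace.proj i)).lpPairing
      (volume.restrict O) 2 2))

theorem pairing_apply (i : Fin d) (u : L2 O d) (w : L2 O k)
    (g : Lp (E k) ⊤ (volume.restrict O)) :
    pairing O k i u w g = ∫ x in O, u x i * (inner ℝ (w x) (g x) : ℝ) := by
  change ((ContinuousLinearMap.mul ℝ ℝ).comp (EuclideanSpace.proj i)).lpPairing
      (volume.restrict O) 2 2 u ((innerSL ℝ).holder 2 w g) = _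
  rw [ContinuousLinearMap.lpPairing_eq_integral]
  refine integral_congr_ae ?_
  filter_upwards [(innerSL ℝ).coeFn_holder (r := 2) w g] with x hx
  rw [hx]
  rfl

/-- If `g` vanishes outside `K`, then the form only sees `u` and `w` on `K`. -/
theorem enorm_pairing_le (i : Fin d) (u : L2 O d) (w : L2 O k)
    (g : Lp (E k) ⊤ (volume.restrict O)) {K : Set (E d)} (hO : MeasurableSet O)
    (hK : K ⊆ O) (hg : ∀ᵐ x ∂volume.restrict O, x ∉ K → g x = 0) :
    ‖pairing O k i u w g‖ₑ ≤
      ‖g‖ₑ * (eLpNorm u 2 (volume.restrict K) * eLpNorm w 2 (volume.restrict K)) := by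
  have hmono : volume.restrict K ≤ volume.restrict O := Measure.restrict_mono hK le_rfl
  have hgb : ∀ᵐ x ∂volume.restrict O, ‖g x‖ₑ ≤ ‖g‖ₑ := by
    rw [Lp.enorm_def, eLpNorm_exponent_top]
    exact ae_le_eLpNormEssSup
  rw [pairing_apply, setIntegral_eq_of_subset_of_ae_sdiff_eq_zero hO.nullMeasurableSet hK]
  · refine (enorm_integral_le_lintegral_enorm _).trans ?_
    have h1 : ∀ᵐ x ∂volume.restrict K, ‖u x i * (inner ℝ (w x) (g x) : ℝ)‖ₑ ≤
        ‖g‖ₑ * ‖‖u x‖ * ‖w x‖‖ₑ := by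
      filter_upwards [ae_mono hmono hgb] with x hx
      have h2 : ‖(inner ℝ (w x) (g x) : ℝ)‖ₑ ≤ ‖w x‖ₑ * ‖g x‖ₑ := by
        rw [← ofReal_norm, ← ofReal_norm, ← ofReal_norm,
          ← ENNReal.ofReal_mul (norm_nonneg _)]
        exact ENNReal.ofReal_le_ofReal (norm_inner_le_norm _ _)
      have h3 : ‖u x i‖ₑ ≤ ‖u x‖ₑ := by
        rw [← ofReal_norm, ← ofReal_norm]
        exact ENNReal.ofReal_le_ofReal (PiLp.norm_apply_le _ _)
      rw [enorm_mul, enorm_mul, enorm_norm, enorm_norm, mul_comm ‖g‖ₑ, mul_assoc]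
      gcongr
      exact h2.trans (by gcongr)
    refine (lintegral_mono_ae h1).trans ?_
    have hum := (Lp.aestronglyMeasurable u).mono_measure hmono
    have hwm := (Lp.aestronglyMeasurable w).mono_measure hmono
    rw [lintegral_const_mul' _ _ enorm_ne_top, ← eLpNorm_one_eq_lintegral_enorm]
    gcongr
    have := eLpNorm_le_eLpNorm_mul_eLpNorm_of_nnnorm (p := 2) (q := 2) (r := 1) hum hwm
      (fun a b => ‖a‖ * ‖b‖) 1 (ae_of_all _ fun x => by simp)
    simpa using this
  · filter_upwards [(ae_restrict_iff' hO).1 hg] with x hx hx'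
    rw [hx hx'.1 hx'.2, inner_zero_right, mul_zero]

theorem enorm_pairing_le_norm (hO : MeasurableSet O) (i : Fin d) (u : L2 O d) (w : L2 O k)
    (g : Lp (E k) ⊤ (volume.restrict O)) :
    ‖pairing O k i u w g‖ₑ ≤ ‖g‖ₑ * (‖u‖ₑ * ‖w‖ₑ) := by
  rw [Lp.enorm_def u, Lp.enorm_def w]
  refine enorm_pairing_le i u w g hO subset_rfl ?_
  filter_upwards [ae_restrict_mem hO] with x hx hx'
  exact absurd hx hx'

/-- The trilinear form `-∑ᵢ Aᵢ(u, w, Dᵢφ)`. -/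
def negSumForm {X Y Z Φ : Type*} [NormedAddCommGroup X] [NormedSpace ℝ X]
    [NormedAddCommGroup Y] [NormedSpace ℝ Y] [NormedAddCommGroup Z] [NormedSpace ℝ Z]
    [AddCommGroup Φ] [Module ℝ Φ] (A : Fin d → X →L[ℝ] Y →L[ℝ] Z →L[ℝ] ℝ)
    (D : Fin d → Φ →ₗ[ℝ] Z) : X →ₗ[ℝ] Y →ₗ[ℝ] Φ →ₗ[ℝ] ℝ where
  toFun u := LinearMap.mk₂ ℝ (fun w φ => -∑ i, A i u w (D i φ))
    (fun w w' φ => by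
      simp only [map_add, add_apply, Finset.sum_add_distrib, neg_add])
    (fun c w φ => by
      simp only [map_smul, smul_apply, ← Finset.smul_sum, smul_neg])
    (fun w φ φ' => by simp only [map_add, Finset.sum_add_distrib, neg_add])
    (fun c w φ => by simp only [map_smul, ← Finset.smul_sum, smul_neg])
  map_add' u u' := by
    ext w φ
    simp only [map_add, add_apply, Finset.sum_add_distrib, neg_add,
      LinearMap.mk₂_apply, LinearMap.add_apply]
  map_smul' c u := by
    ext w φ
    simp only [map_smul, smul_apply, ← Finset.smul_sum, smul_neg,
      LinearMap.mk₂_apply, LinearMap.smul_apply, RingHom.id_apply]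

/-- The form `-∑ᵢ ∫_O uᵢ w · Dᵢφ dx`, in which the derivatives fall on `φ`. -/
def convectiveForm (D : Fin d → Hm₀ m O k →ₗ[ℝ] Lp (E k) ⊤ (volume.restrict O)) :
    H₀ O →ₗ[ℝ] L2 O k →ₗ[ℝ] Hm₀ m O k →ₗ[ℝ] ℝ :=
  (negSumForm (pairing O k) D).comp (H₀ O).subtype

theorem convectiveForm_apply (D : Fin d → Hm₀ m O k →ₗ[ℝ] Lp (E k) ⊤ (volume.restrict O))
    (u : H₀ O) (w : L2 O k) (φ : Hm₀ m O k) :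
    convectiveForm D u w φ = -∑ i, pairing O k i (u : L2 O d) w (D i φ) := rfl

/-- The factor `a` is left free to cover two cases: the norms on all of `O` for boundedness, and the
norms on a set containing the support of a test function for locality. -/
theorem enorm_convectiveForm_le {D : Fin d → Hm₀ m O k →ₗ[ℝ] Lp (E k) ⊤ (volume.restrict O)}
    {u : H₀ O} {w : L2 O k} {φ : Hm₀ m O k} {A a : ℝ≥0∞} (hD : ∀ i, ‖D i φ‖ₑ ≤ A)
    (h : ∀ i, ‖pairing O k i (u : L2 O d) w (D i φ)‖ₑ ≤ ‖D i φ‖ₑ * a) :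
    ‖convectiveForm D u w φ‖ₑ ≤ d * A * a := by
  rw [convectiveForm_apply, enorm_neg]
  refine (enorm_sum_le _ _).trans ?_
  refine (Finset.sum_le_sum fun i _ => (h i).trans (mul_le_mul_left (hD i) a)).trans ?_
  simp [mul_assoc]

theorem formb_eq_sum_pairing {P : Hm₀ m O k →ₗ[ℝ] Lp (E k) ⊤ (volume.restrict O)}
    {φ : Hm₀ m O k} (hP : P φ =ᵐ[volume.restrict O] (φ : L2 O k)) (u : L2 O d)
    (G : Fin d → L2 O k) : formb u G (φ : L2 O k) = ∑ i, pairing O k i u (G i) (P φ) := by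
  refine Finset.sum_congr rfl fun i _ => ?_
  rw [pairing_apply]
  refine integral_congr_ae ?_
  filter_upwards [hP] with x hx
  rw [hx]

/-- A linear functional on `Hᵐ₀` which is bounded by the norm and vanishes on test functions
vanishes. -/
theorem eq_zero_of_vanishes_on_test (L : Hm₀ m O k →ₗ[ℝ] ℝ) {C : ℝ≥0}
    (hC : ∀ φ : Hm₀ m O k, ‖L φ‖ₑ ≤ C * sobolevENorm m (φ : L2 O k))
    (h : ∀ φ : Hm₀ m O k, (φ : L2 O k) ∈ testSpace O k → L φ = 0) : L = 0 := by
  ext φ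
  rw [LinearMap.zero_apply, ← enorm_eq_zero]
  refine le_antisymm (le_of_forall_pos_le_add fun ε hε => ?_) zero_le
  rcases eq_or_ne ε ⊤ with rfl | hε'
  · simp
  -- The `+ 1` keeps the quotient meaningful when `C = 0`.
  obtain ⟨f, hf, hf'⟩ := φ.2 (ε / (C + 1)) (ENNReal.div_pos hε.ne' (by finiteness))
  have h1 := hC (φ - ⟨f, testSpace_le_Hm₀ m hf⟩)
  rw [map_sub, h ⟨f, testSpace_le_Hm₀ m hf⟩ hf, sub_zero] at h1
  refine (h1.trans ?_).trans (zero_add ε).ge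
  calc (C : ℝ≥0∞) * sobolevENorm m ((φ : L2 O k) - f) ≤ (C + 1) * (ε / (C + 1)) := by
        gcongr
        exact le_self_add
    _ ≤ ε := ENNReal.mul_div_le

theorem eq_of_eq_on_test {L L' : Hm₀ m O k →ₗ[ℝ] ℝ} {C C' : ℝ≥0}
    (hL : ∀ φ : Hm₀ m O k, ‖L φ‖ₑ ≤ C * sobolevENorm m (φ : L2 O k))
    (hL' : ∀ φ : Hm₀ m O k, ‖L' φ‖ₑ ≤ C' * sobolevENorm m (φ : L2 O k))
    (h : ∀ φ : Hm₀ m O k, (φ : L2 O k) ∈ testSpace O k → L φ = L' φ) : L = L' := by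
  rw [← sub_eq_zero]
  refine eq_zero_of_vanishes_on_test (C := C + C') (L - L') (fun φ => ?_) fun φ hφ => ?_
  · rw [LinearMap.sub_apply, ENNReal.coe_add, add_mul]
    exact enorm_sub_le.trans (add_le_add (hL φ) (hL' φ))
  · rw [LinearMap.sub_apply, h φ hφ, sub_self]

theorem IsSobolevEmbedding.deriv_test {P : Hm₀ m O k →ₗ[ℝ] Lp (E k) ⊤ (volume.restrict O)}
    {D : Fin d → Hm₀ m O k →ₗ[ℝ] Lp (E k) ⊤ (volume.restrict O)} {C : ℝ≥0}
    (hPD : IsSobolevEmbedding P D C) (hO : IsOpen O) {φ : Hm₀ m O k} {g : E d → E k}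
    (hg : IsTestFunction O g) (hφ : (φ : L2 O k) =ᵐ[volume.restrict O] g) (i : Fin d) :
    D i φ =ᵐ[volume.restrict O] partialDeriv i g :=
  (hPD.deriv i φ).ae_eq hO hφ (locallyIntegrable_Lp le_top _)
    (((hg.partialDeriv i).memLp 2).locallyIntegrable one_le_two) (hg.isWeakPartialDeriv i)

theorem enorm_convectiveForm_le_norm (hO : IsOpen O)
    {P : Hm₀ m O k →ₗ[ℝ] Lp (E k) ⊤ (volume.restrict O)}
    {D : Fin d → Hm₀ m O k →ₗ[ℝ] Lp (E k) ⊤ (volume.restrict O)} {C : ℝ≥0}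
    (hPD : IsSobolevEmbedding P D C) (u : H₀ O) (w : L2 O k) (φ : Hm₀ m O k) :
    ‖convectiveForm D u w φ‖ₑ ≤
      (d * C : ℝ≥0) * ‖u‖ₑ * ‖w‖ₑ * sobolevENorm m (φ : L2 O k) := by
  refine (enorm_convectiveForm_le (fun i => hPD.bound_deriv i φ) fun i =>
    enorm_pairing_le_norm hO.measurableSet i u w (D i φ)).trans (le_of_eq ?_)
  rw [show ‖(u : L2 O d)‖ₑ = ‖u‖ₑ from rfl]
  push_cast
  ring

theorem continuous_sum_clm {X Y Z : Type*} [NormedAddCommGroup X] [NormedSpace ℝ X]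
    [NormedAddCommGroup Y] [NormedSpace ℝ Y] [NormedAddCommGroup Z] [NormedSpace ℝ Z]
    (A : Fin d → X →L[ℝ] Y →L[ℝ] Z →L[ℝ] ℝ) (y : Fin d → Y) (z : Fin d → Z) :
    Continuous fun u => ∑ i, A i u (y i) (z i) := by
  fun_prop

/-- If `φ` is a test function, then integration by parts in `b` is possible for all `u ∈ H₀`. -/
theorem neg_sum_pairing_eq_of_test (hO : IsOpen O)
    {P : Hm₀ m O k →ₗ[ℝ] Lp (E k) ⊤ (volume.restrict O)}
    {D : Fin d → Hm₀ m O k →ₗ[ℝ] Lp (E k) ⊤ (volume.restrict O)} {C : ℝ≥0}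
    (hPD : IsSobolevEmbedding P D C) {u : L2 O d} (hu : u ∈ H₀ O) {w : L2 O k} {G : Fin d → L2 O k}
    (hG : IsWeakGradient w G) {φ : Hm₀ m O k} (hφ : (φ : L2 O k) ∈ testSpace O k) :
    -∑ i, pairing O k i u w (D i φ) = ∑ i, pairing O k i u (G i) (P φ) := by
  obtain ⟨g, hg, hφg⟩ := hφ
  -- Both sides are `L²`-continuous in `u`, so the identity need only be checked on `𝒱₀`, where it
  -- is the classical integration by parts.
  refine closure_minimal (s := (solenoidalTestSpace O : Set (L2 O d)))
    (t := {u | -∑ i, pairing O k i u w (D i φ) = ∑ i, pairing O k i u (G i) (P φ)}) ?_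
    (isClosed_eq (continuous_sum_clm _ (fun _ => w) fun i => D i φ).neg
      (continuous_sum_clm _ G fun _ => P φ)) hu
  rintro u ⟨f, hf, hdiv, huf⟩
  have h := sum_integral_solenoidal hf hdiv (locallyIntegrable_Lp one_le_two w)
    (fun i => locallyIntegrable_Lp one_le_two (G i)) (fun i => hG i) hg
  have h1 : ∑ i, pairing O k i u (G i) (P φ) =
      ∑ i, ∫ x in O, f x i * (inner ℝ (G i x) (g x) : ℝ) := by
    refine Finset.sum_congr rfl fun i _ => ?_
    rw [pairing_apply]
    refine integral_congr_ae ?_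
    filter_upwards [huf, hφg, hPD.coe_ae φ] with x h1 h2 h3
    rw [h1, h3, h2]
  have h2 : ∑ i, pairing O k i u w (D i φ) =
      ∑ i, ∫ x in O, f x i * (inner ℝ (w x) (partialDeriv i g x) : ℝ) := by
    refine Finset.sum_congr rfl fun i _ => ?_
    rw [pairing_apply]
    refine integral_congr_ae ?_
    filter_upwards [huf, hPD.deriv_test hO hg hφg i] with x h1 h2
    rw [h1, h2]
  rw [mem_ofPred_eq, h1, h2, h]

theorem exists_sum_clm_comp {Z Φ : Type*} [NormedAddCommGroup Z] [NormedSpace ℝ Z]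
    [AddCommGroup Φ] [Module ℝ Φ] (A : Fin d → Z →L[ℝ] ℝ) (P : Φ →ₗ[ℝ] Z) :
    ∃ L : Φ →ₗ[ℝ] ℝ, ∀ φ, L φ = ∑ i, A i (P φ) :=
  ⟨∑ i, (A i).toLinearMap ∘ₗ P, fun φ => by simp⟩

/-- For fixed `u` and gradient `G`, this makes `b(u, w, ·)` a bounded functional on `Hᵐ₀`, so that
it is determined by its values on test functions. -/
theorem enorm_sum_pairing_le (hO : IsOpen O)
    {P : Hm₀ m O k →ₗ[ℝ] Lp (E k) ⊤ (volume.restrict O)} {C : ℝ≥0}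
    (hP : ∀ φ : Hm₀ m O k, ‖P φ‖ₑ ≤ C * sobolevENorm m (φ : L2 O k)) (u : L2 O d)
    (G : Fin d → L2 O k) : ∃ c : ℝ≥0, ∀ φ : Hm₀ m O k,
      ‖∑ i, pairing O k i u (G i) (P φ)‖ₑ ≤ c * sobolevENorm m (φ : L2 O k) := by
  refine ⟨∑ i, C * (‖u‖₊ * ‖G i‖₊), fun φ => ?_⟩
  rw [ENNReal.ofNNReal_finsetSum, Finset.sum_mul]
  refine (enorm_sum_le _ _).trans (Finset.sum_le_sum fun i _ => ?_)
  refine (enorm_pairing_le_norm hO.measurableSet i u (G i) (P φ)).trans ?_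
  rw [ENNReal.coe_mul, mul_right_comm]
  exact mul_le_mul_left (hP φ) _

-- For fixed `u` and `w`, the form and `b(u, w, ·)` are both bounded by the `Hᵐ` norm and agree on
-- test functions by `neg_sum_pairing_eq_of_test`, hence on their closure `Hᵐ₀`.
set_option maxHeartbeats 1000000 in
theorem convectiveForm_isExtensionOfb (hO : IsOpen O)
    {P : Hm₀ m O k →ₗ[ℝ] Lp (E k) ⊤ (volume.restrict O)}
    {D : Fin d → Hm₀ m O k →ₗ[ℝ] Lp (E k) ⊤ (volume.restrict O)} {C : ℝ≥0}
    (hPD : IsSobolevEmbedding P D C) : IsExtensionOfb m O k (convectiveForm D) := by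
  refine ⟨⟨d * C, enorm_convectiveForm_le_norm hO hPD⟩, fun u w G _ hG φ => ?_⟩
  rw [formb_eq_sum_pairing (hPD.coe_ae φ)]
  obtain ⟨c₁, hc₁⟩ : ∃ c : ℝ≥0, ∀ φ : Hm₀ m O k,
      ‖convectiveForm D u w φ‖ₑ ≤ c * sobolevENorm m (φ : L2 O k) :=
    ⟨d * C * ‖u‖₊ * ‖w‖₊, enorm_convectiveForm_le_norm hO hPD u w⟩
  obtain ⟨c₂, hc₂⟩ := enorm_sum_pairing_le hO hPD.bound (u : L2 O d) G
  obtain ⟨L, hL⟩ := exists_sum_clm_comp (fun i => pairing O k i (u : L2 O d) (G i)) P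
  rw [← hL]
  refine LinearMap.congr_fun (eq_of_eq_on_test hc₁ (fun φ => by rw [hL]; exact hc₂ φ)
    fun φ hφ => ?_) φ
  rw [hL, convectiveForm_apply]
  exact neg_sum_pairing_eq_of_test hO hPD u.2 hG hφ

/-- For fixed `φ`, a bounded extension of `b` is a continuous bilinear form in `u` and `w`. -/
theorem IsExtensionOfb.exists_clm {B : H₀ O →ₗ[ℝ] L2 O k →ₗ[ℝ] Hm₀ m O k →ₗ[ℝ] ℝ}
    (hB : IsExtensionOfb m O k B) (φ : Hm₀ m O k) :
    ∃ A : H₀ O →L[ℝ] L2 O k →L[ℝ] ℝ, ∀ u w, A u w = B u w φ := by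
  obtain ⟨C, hC⟩ := hB.bounded
  refine ⟨LinearMap.mkContinuous₂ (LinearMap.mk₂ ℝ (fun u w => B u w φ) (by simp) (by simp)
    (by simp) (by simp)) (C * (sobolevENorm m (φ : L2 O k)).toReal) fun u w => ?_,
    fun u w => rfl⟩
  have h := ENNReal.toReal_mono ?_ (hC u w φ)
  · rw [toReal_enorm] at h
    refine h.trans (le_of_eq ?_)
    simp
    ring
  · have := sobolevENorm_ne_top φ
    finiteness

theorem clm_ext_on_closure {X Z : Type*} [NormedAddCommGroup X] [NormedSpace ℝ X]
    [NormedAddCommGroup Z] [NormedSpace ℝ Z] {S S' : Submodule ℝ X}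
    (hS : S' = S.topologicalClosure) {T : Set Z} (hT : Dense T) {A A' : S' →L[ℝ] Z →L[ℝ] ℝ}
    (h : ∀ u : S', (u : X) ∈ S → ∀ w ∈ T, A u w = A' u w) : A = A' := by
  subst hS
  have hc : IsClosed {u | A u = A' u} := isClosed_eq A.continuous A'.continuous
  refine ContinuousLinearMap.ext fun u => ?_
  obtain ⟨x, hx, hxu⟩ := mem_closure_iff_seq_limit.1 u.2
  have hx' (n : ℕ) : x n ∈ S.topologicalClosure := S.le_topologicalClosure (hx n)
  have hu : u ∈ {u | A u = A' u} := by
    refine hc.mem_of_tendsto (f := fun n => (⟨x n, hx' n⟩ : S.topologicalClosure)) (b := atTop)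
      (tendsto_subtype_rng.2 hxu) (Eventually.of_forall fun n => ?_)
    exact DFunLike.coe_injective (Continuous.ext_on hT (A _).continuous (A' _).continuous
      fun w hw => h _ (hx n) w hw)
  exact hu

-- Test functions are of class `H¹`, so both maps equal `b` on `𝒱₀ × C_c^∞`. This set is dense in
-- `H₀ × L²`, and for fixed `φ` both maps are continuous there.
set_option maxHeartbeats 1000000 in
theorem IsExtensionOfb.unique (hO : IsOpen O)
    {B B' : H₀ O →ₗ[ℝ] L2 O k →ₗ[ℝ] Hm₀ m O k →ₗ[ℝ] ℝ}
    (hB : IsExtensionOfb m O k B) (hB' : IsExtensionOfb m O k B') : B = B' := by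
  ext u w φ
  obtain ⟨A, hA⟩ := hB.exists_clm φ
  obtain ⟨A', hA'⟩ := hB'.exists_clm φ
  rw [← hA, ← hA']
  have hAA' : A = A' := by
    refine clm_ext_on_closure (S := solenoidalTestSpace O) (S' := H₀ O) rfl (dense_testSpace hO k) ?_
    rintro u ⟨f, hf, -, huf⟩ w ⟨g, hg, hwg⟩
    obtain ⟨G, hG⟩ := memH1_of_test hg hwg
    rw [hA, hA', hB.extends_b u w G (memH1_of_test hf huf) hG,
      hB'.extends_b u w G (memH1_of_test hf huf) hG]
  rw [hAA']

/-- The form vanishes outside the support of a test function. -/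
theorem IsExtensionOfb.enorm_test_le (hO : IsOpen O) (hm : (d : ℝ) / 2 + 1 < m)
    {B : H₀ O →ₗ[ℝ] L2 O k →ₗ[ℝ] Hm₀ m O k →ₗ[ℝ] ℝ} (hB : IsExtensionOfb m O k B)
    {φ : Hm₀ m O k} {g : E d → E k} (hg : IsTestFunction O g)
    (hφ : (φ : L2 O k) =ᵐ[volume.restrict O] g) :
    ∃ C : ℝ≥0, ∀ K : Set (E d), tsupport g ⊆ K → K ⊆ O → ∀ u w,
      ‖B u w φ‖ₑ ≤ C * (eLpNorm (u : L2 O d) 2 (volume.restrict K) *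
        eLpNorm w 2 (volume.restrict K)) := by
  obtain ⟨P, D, C, hPD⟩ := exists_isSobolevEmbedding hO hm k
  -- Uniqueness replaces the abstract extension by the explicit formula, in which only derivatives
  -- of `g` appear; these vanish off its support.
  obtain rfl := hB.unique hO (convectiveForm_isExtensionOfb hO hPD)
  refine ⟨d * (C * (sobolevENorm m (φ : L2 O k)).toNNReal), fun K hgK hK u w => ?_⟩
  push_cast
  rw [ENNReal.coe_toNNReal (sobolevENorm_ne_top φ)]
  refine enorm_convectiveForm_le (fun i => hPD.bound_deriv i φ) fun i =>
    enorm_pairing_le i u w (D i φ) hO.measurableSet hK ?_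
  filter_upwards [hPD.deriv_test hO hg hφ i] with x hx hxK
  rw [hx]
  exact image_eq_zero_of_notMem_tsupport fun h =>
    hxK (hgK (tsupport_partialDeriv_subset i g h))

end

noncomputable section

variable {d k : ℕ} {O : Set (E d)} {m : ℝ}

/-! ### Time-dependent functions -/

theorem lintegral_mul_le_L2 {α : Type*} [MeasurableSpace α] {μ : Measure α} {f g : α → ℝ≥0∞}
    (hf : AEMeasurable f μ) (hg : AEMeasurable g μ) :
    ∫⁻ s, f s * g s ∂μ ≤
      (∫⁻ s, f s ^ 2 ∂μ) ^ (1 / 2 : ℝ) * (∫⁻ s, g s ^ 2 ∂μ) ^ (1 / 2 : ℝ) := by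
  have h := ENNReal.lintegral_mul_le_Lp_mul_Lq μ Real.HolderConjugate.two_two hf hg
  simpa only [Pi.mul_apply, ENNReal.rpow_ofNat] using h

theorem eLpNorm_two_eq_lintegral {α G : Type*} [MeasurableSpace α] {μ : Measure α}
    [NormedAddCommGroup G] (f : α → G) :
    eLpNorm f 2 μ = (∫⁻ x, ‖f x‖ₑ ^ 2 ∂μ) ^ (1 / 2 : ℝ) := by
  rw [eLpNorm_eq_lintegral_rpow_enorm_toReal (by norm_num) (by norm_num)]
  simp

/-- Restriction to `K` is a continuous linear map on `L²`. The continuity provides the measurability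
in time of local norms that Cauchy-Schwarz requires. -/
theorem continuous_eLpNorm_restrict {K : Set (E d)} (hK : K ⊆ O) :
    Continuous fun f : L2 O k => eLpNorm f 2 (volume.restrict K) := by
  have h (f : L2 O k) : eLpNorm f 2 (volume.restrict K) =
      ‖LpToLpRestrictCLM (E d) (E k) ℝ (volume.restrict O) 2 K f‖ₑ := by
    rw [Lp.enorm_def, eLpNorm_congr_ae (LpToLpRestrictCLM_coeFn ℝ K f),
      Measure.restrict_restrict_of_subset hK]
  simp_rw [h]
  fun_prop

theorem locSeminorm_eq (T : ℝ) (K : Set (E d)) (f : ℝ → L2 O k) :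
    locSeminorm T K f =
      (∫⁻ t in Icc 0 T, eLpNorm (f t) 2 (volume.restrict K) ^ 2) ^ (1 / 2 : ℝ) := by
  rw [locSeminorm]
  congr 1
  refine lintegral_congr fun t => ?_
  rw [eLpNorm_two_eq_lintegral, ← ENNReal.rpow_ofNat, ← ENNReal.rpow_mul]
  norm_num

theorem exists_pos_mul_le {a ε : ℝ≥0∞} (ha : a ≠ ⊤) (hε : 0 < ε) : ∃ η, 0 < η ∧ a * η ≤ ε := by
  refine ⟨ε / (a + 1), ENNReal.div_pos hε.ne' (by finiteness), ?_⟩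
  calc a * (ε / (a + 1)) ≤ (a + 1) * (ε / (a + 1)) := by
        gcongr
        exact le_self_add
    _ ≤ ε := ENNReal.mul_div_le

theorem IsExhaustion.exists_subset {OR : ℕ → Set (E d)} (hOR : IsExhaustion O OR)
    {K : Set (E d)} (hK : IsCompact K) (hKO : K ⊆ O) : ∃ R, K ⊆ OR R :=
  hK.elim_directed_cover OR hOR.isOpen (by rwa [hOR.iUnion])
    (monotone_nat_of_le_succ hOR.mono).directed_le

theorem IsExhaustion.subset {OR : ℕ → Set (E d)} (hOR : IsExhaustion O OR) (R : ℕ) : OR R ⊆ O := by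
  rw [← hOR.iUnion]
  exact subset_iUnion OR R

theorem IsExtensionOfb.aestronglyMeasurable
    {B : H₀ O →ₗ[ℝ] L2 O k →ₗ[ℝ] Hm₀ m O k →ₗ[ℝ] ℝ} (hB : IsExtensionOfb m O k B)
    (φ : Hm₀ m O k) {μ : Measure ℝ} {u : ℝ → H₀ O} {w : ℝ → L2 O k}
    (hu : AEStronglyMeasurable u μ) (hw : AEStronglyMeasurable w μ) :
    AEStronglyMeasurable (fun s => B (u s) (w s) φ) μ := by
  obtain ⟨A, hA⟩ := hB.exists_clm φ
  simp_rw [← hA]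
  exact A.aestronglyMeasurable_comp₂ hu hw

/-- `⟨B(u(·), w(·)), φ⟩` is bounded in `L¹` by the `L²` norms of `u` and `w`. -/
theorem IsExtensionOfb.exists_lintegral_le
    {B : H₀ O →ₗ[ℝ] L2 O k →ₗ[ℝ] Hm₀ m O k →ₗ[ℝ] ℝ} (hB : IsExtensionOfb m O k B) :
    ∃ C : ℝ≥0, ∀ (φ : Hm₀ m O k) (μ : Measure ℝ) (u : ℝ → H₀ O) (w : ℝ → L2 O k),
      AEStronglyMeasurable u μ → AEStronglyMeasurable w μ →
      ∫⁻ s, ‖B (u s) (w s) φ‖ₑ ∂μ ≤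
        C * sobolevENorm m (φ : L2 O k) * (eLpNorm u 2 μ * eLpNorm w 2 μ) := by
  obtain ⟨C, hC⟩ := hB.bounded
  refine ⟨C, fun φ μ u w hu hw => ?_⟩
  have hfin : (C : ℝ≥0∞) * sobolevENorm m (φ : L2 O k) ≠ ⊤ :=
    ENNReal.mul_ne_top ENNReal.coe_ne_top (sobolevENorm_ne_top φ)
  calc ∫⁻ s, ‖B (u s) (w s) φ‖ₑ ∂μ
      ≤ ∫⁻ s, C * sobolevENorm m (φ : L2 O k) * (‖u s‖ₑ * ‖w s‖ₑ) ∂μ :=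
        lintegral_mono fun s => (hC (u s) (w s) φ).trans (le_of_eq (by ring))
    _ = C * sobolevENorm m (φ : L2 O k) * ∫⁻ s, ‖u s‖ₑ * ‖w s‖ₑ ∂μ :=
        lintegral_const_mul' _ _ hfin
    _ ≤ _ := by
        gcongr
        rw [eLpNorm_two_eq_lintegral u, eLpNorm_two_eq_lintegral w]
        exact lintegral_mul_le_L2 hu.enorm hw.enorm

theorem IsExtensionOfb.integrable
    {B : H₀ O →ₗ[ℝ] L2 O k →ₗ[ℝ] Hm₀ m O k →ₗ[ℝ] ℝ} (hB : IsExtensionOfb m O k B)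
    (φ : Hm₀ m O k) {μ : Measure ℝ} {u : ℝ → H₀ O} {w : ℝ → L2 O k}
    (hu : MemLp u 2 μ) (hw : MemLp w 2 μ) : Integrable (fun s => B (u s) (w s) φ) μ := by
  obtain ⟨C, hC⟩ := hB.exists_lintegral_le
  refine ⟨hB.aestronglyMeasurable φ hu.1 hw.1, (hC φ μ u w hu.1 hw.1).trans_lt ?_⟩
  have := sobolevENorm_ne_top φ
  have := hu.2.ne
  have := hw.2.ne
  finiteness

/-- For a test function `ψ` supported in `K`, the form is controlled by norms on `K`. -/
theorem lintegral_test_le {B : H₀ O →ₗ[ℝ] L2 O k →ₗ[ℝ] Hm₀ m O k →ₗ[ℝ] ℝ} {ψ : Hm₀ m O k}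
    {C : ℝ≥0} {K : Set (E d)} (hK : K ⊆ O)
    (hC : ∀ u w, ‖B u w ψ‖ₑ ≤ C * (eLpNorm (u : L2 O d) 2 (volume.restrict K) *
      eLpNorm w 2 (volume.restrict K))) {T : ℝ} {u : ℝ → H₀ O} {w : ℝ → L2 O k}
    (hu : AEStronglyMeasurable u (timeMeasure T)) (hw : AEStronglyMeasurable w (timeMeasure T)) :
    ∫⁻ s in Icc 0 T, ‖B (u s) (w s) ψ‖ₑ ≤
      C * (locSeminorm T K (fun s => (u s : L2 O d)) * locSeminorm T K w) := by
  rw [locSeminorm_eq, locSeminorm_eq]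
  refine (lintegral_mono fun s => hC (u s) (w s)).trans ?_
  rw [lintegral_const_mul' _ _ ENNReal.coe_ne_top]
  gcongr
  refine lintegral_mul_le_L2 ?_ ?_
  · exact (((continuous_eLpNorm_restrict hK).comp continuous_subtype_val).comp_aestronglyMeasurable
      hu).aemeasurable
  · exact ((continuous_eLpNorm_restrict hK).comp_aestronglyMeasurable hw).aemeasurable

theorem locSeminorm_le_eLpNorm {K : Set (E d)} (hK : K ⊆ O) (T : ℝ) (w : ℝ → L2 O k) :
    locSeminorm T K w ≤ eLpNorm w 2 (timeMeasure T) := by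
  rw [locSeminorm_eq, eLpNorm_two_eq_lintegral]
  gcongr with t
  rw [Lp.enorm_def]
  exact eLpNorm_mono_measure _ (Measure.restrict_mono hK le_rfl)

/-- Replacing `φ` by `ψ` leaves the two remainders in `φ - ψ`; the difference at `ψ` is then
telescoped, changing `u` and `w` one at a time. -/
theorem enorm_trilinear_sub_le {X Y Φ : Type*} [AddCommGroup X] [Module ℝ X] [AddCommGroup Y]
    [Module ℝ Y] [AddCommGroup Φ] [Module ℝ Φ] (B : X →ₗ[ℝ] Y →ₗ[ℝ] Φ →ₗ[ℝ] ℝ) (u u' : X)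
    (w w' : Y) (φ ψ : Φ) : ‖B u' w' φ - B u w φ‖ₑ ≤
      ‖B u' w' (φ - ψ)‖ₑ + ‖B u w (φ - ψ)‖ₑ + ‖B (u' - u) w' ψ‖ₑ + ‖B u (w' - w) ψ‖ₑ := by
  have h : B u' w' φ - B u w φ =
      B u' w' (φ - ψ) - B u w (φ - ψ) + B (u' - u) w' ψ + B u (w' - w) ψ := by
    simp only [map_sub, LinearMap.sub_apply]
    ring
  rw [h]
  exact (enorm_add_le _ _).trans (add_le_add ((enorm_add_le _ _).trans
    (add_le_add enorm_sub_le le_rfl)) le_rfl)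

theorem lintegral_le_of_le_add_four {α : Type*} [MeasurableSpace α] {μ : Measure α}
    {f f₁ f₂ f₃ f₄ : α → ℝ≥0∞} {a₁ a₂ a₃ a₄ : ℝ≥0∞} (h : ∀ s, f s ≤ f₁ s + f₂ s + f₃ s + f₄ s)
    (hm₁ : AEMeasurable f₁ μ) (hm₂ : AEMeasurable f₂ μ) (hm₃ : AEMeasurable f₃ μ)
    (h₁ : ∫⁻ s, f₁ s ∂μ ≤ a₁) (h₂ : ∫⁻ s, f₂ s ∂μ ≤ a₂) (h₃ : ∫⁻ s, f₃ s ∂μ ≤ a₃)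
    (h₄ : ∫⁻ s, f₄ s ∂μ ≤ a₄) : ∫⁻ s, f s ∂μ ≤ a₁ + a₂ + a₃ + a₄ := by
  refine (lintegral_mono h).trans ?_
  rw [lintegral_add_left' (f := fun s => f₁ s + f₂ s + f₃ s) ((hm₁.add hm₂).add hm₃),
    lintegral_add_left' (f := fun s => f₁ s + f₂ s) (hm₁.add hm₂),
    lintegral_add_left' hm₁]
  gcongr

set_option maxHeartbeats 1000000 in
/-- On bounded sets, `(u, w) ↦ ⟨B(u(·), w(·)), φ⟩` is uniformly continuous into `L¹(0, T)` for
local convergence. -/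
theorem IsExtensionOfb.exists_locSeminorm_lt (hO : IsOpen O) (hm : (d : ℝ) / 2 + 1 < m)
    {OR : ℕ → Set (E d)} (hOR : IsExhaustion O OR) (T : ℝ)
    {B : H₀ O →ₗ[ℝ] L2 O k →ₗ[ℝ] Hm₀ m O k →ₗ[ℝ] ℝ} (hB : IsExtensionOfb m O k B)
    (φ : Hm₀ m O k) {M : ℝ≥0∞} (hM : M ≠ ⊤) {ε : ℝ≥0∞} (hε : 0 < ε) :
    ∃ (R : ℕ) (δ : ℝ≥0∞), 0 < δ ∧ ∀ (u u' : ℝ → H₀ O) (w w' : ℝ → L2 O k),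
      AEStronglyMeasurable u (timeMeasure T) → AEStronglyMeasurable u' (timeMeasure T) →
      AEStronglyMeasurable w (timeMeasure T) → AEStronglyMeasurable w' (timeMeasure T) →
      eLpNorm u 2 (timeMeasure T) ≤ M → eLpNorm u' 2 (timeMeasure T) ≤ M →
      eLpNorm w 2 (timeMeasure T) ≤ M → eLpNorm w' 2 (timeMeasure T) ≤ M →
      locSeminorm T (OR R) (fun s => ((u' s - u s : H₀ O) : L2 O d)) < δ →
      locSeminorm T (OR R) (fun s => w' s - w s) < δ →
      ∫⁻ s in Icc 0 T, ‖B (u' s) (w' s) φ - B (u s) (w s) φ‖ₑ ≤ ε := by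
  obtain ⟨C, hC⟩ := hB.exists_lintegral_le
  -- Each of the two remainders in `φ - ψ` costs at most `C η M²`; together they get half of `ε`.
  obtain ⟨η, hη, hηε⟩ := exists_pos_mul_le (a := 2 * C * (M * M)) (by finiteness)
    (ENNReal.half_pos hε.ne')
  obtain ⟨v, hv, hφv⟩ := φ.2 η hη
  have hv' := hv
  obtain ⟨g, hg, hvg⟩ := hv'
  set ψ : Hm₀ m O k := ⟨v, testSpace_le_Hm₀ m hv⟩
  obtain ⟨C', hC'⟩ := hB.enorm_test_le hO hm (φ := ψ) hg hvg
  obtain ⟨R, hR⟩ := hOR.exists_subset hg.compact hg.support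
  have hRO := hOR.subset R
  -- The constant `C'` depends on `ψ`, so `δ` is fixed only after `η`. None of `ψ`, `R`, `δ` depends
  -- on `u` or `w`, whence the uniformity.
  obtain ⟨δ, hδ, hδε⟩ := exists_pos_mul_le (a := 2 * C' * M) (by finiteness)
    (ENNReal.half_pos hε.ne')
  refine ⟨R, δ, hδ, fun u u' w w' hum hum' hwm hwm' hu hu' hw hw' hδu hδw => ?_⟩
  have hφψ : sobolevENorm m ((φ - ψ : Hm₀ m O k) : L2 O k) ≤ η := hφv.le
  have h1 : ∫⁻ s in Icc 0 T, ‖B (u' s) (w' s) (φ - ψ)‖ₑ ≤ C * η * (M * M) :=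
    (hC _ _ _ _ hum' hwm').trans (by gcongr)
  have h2 : ∫⁻ s in Icc 0 T, ‖B (u s) (w s) (φ - ψ)‖ₑ ≤ C * η * (M * M) :=
    (hC _ _ _ _ hum hwm).trans (by gcongr)
  have h3 : ∫⁻ s in Icc 0 T, ‖B (u' s - u s) (w' s) ψ‖ₑ ≤ C' * (δ * M) :=
    (lintegral_test_le hRO (hC' _ hR hRO) (hum'.sub hum) hwm').trans
      (mul_le_mul' le_rfl (mul_le_mul' hδu.le ((locSeminorm_le_eLpNorm hRO T w').trans hw')))
  have h4 : ∫⁻ s in Icc 0 T, ‖B (u s) (w' s - w s) ψ‖ₑ ≤ C' * (M * δ) :=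
    (lintegral_test_le hRO (hC' _ hR hRO) hum (hwm'.sub hwm)).trans
      (mul_le_mul' le_rfl (mul_le_mul' ((locSeminorm_le_eLpNorm hRO T _).trans hu) hδw.le))
  calc ∫⁻ s in Icc 0 T, ‖B (u' s) (w' s) φ - B (u s) (w s) φ‖ₑ
      ≤ C * η * (M * M) + C * η * (M * M) + C' * (δ * M) + C' * (M * δ) :=
        lintegral_le_of_le_add_four (fun s => enorm_trilinear_sub_le B _ _ _ _ φ ψ)
          (hB.aestronglyMeasurable _ hum' hwm').enorm (hB.aestronglyMeasurable _ hum hwm).enorm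
          (hB.aestronglyMeasurable _ (hum'.sub hum) hwm').enorm h1 h2 h3 h4
    _ = 2 * C * (M * M) * η + 2 * C' * M * δ := by ring
    _ ≤ ε / 2 + ε / 2 := add_le_add hηε hδε
    _ = ε := ENNReal.add_halves ε

theorem eLpNorm_Lp_le {X : Type*} [NormedAddCommGroup X] {μ : Measure ℝ} (u : Lp X 2 μ) {M : ℝ}
    (h : ‖u‖ ≤ M) : eLpNorm u 2 μ ≤ ENNReal.ofReal M := by
  rw [← Lp.enorm_def, ← ofReal_norm]
  exact ENNReal.ofReal_le_ofReal h

set_option maxHeartbeats 1000000 in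
theorem IsExtensionOfb.tendsto_integral (hO : IsOpen O) (hm : (d : ℝ) / 2 + 1 < m)
    {OR : ℕ → Set (E d)} (hOR : IsExhaustion O OR) {T : ℝ}
    {B : H₀ O →ₗ[ℝ] L2 O k →ₗ[ℝ] Hm₀ m O k →ₗ[ℝ] ℝ} (hB : IsExtensionOfb m O k B)
    (u : Lp (H₀ O) 2 (timeMeasure T)) (un : ℕ → Lp (H₀ O) 2 (timeMeasure T))
    (w : Lp (L2 O k) 2 (timeMeasure T)) (wn : ℕ → Lp (L2 O k) 2 (timeMeasure T))
    (hun : ∃ M : ℝ, ∀ n, ‖un n‖ ≤ M) (hwn : ∃ M : ℝ, ∀ n, ‖wn n‖ ≤ M)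
    (hu : ∀ R, Tendsto (fun n => locSeminorm T (OR R)
      fun s => ((un n s - u s : H₀ O) : L2 O d)) atTop (𝓝 0))
    (hw : ∀ R, Tendsto (fun n => locSeminorm T (OR R) fun s => wn n s - w s) atTop (𝓝 0))
    (φ : Hm₀ m O k) {t : ℝ} (ht : t ∈ Icc 0 T) :
    Tendsto (fun n => ∫ s in 0..t, B (un n s) (wn n s) φ) atTop
      (𝓝 (∫ s in 0..t, B (u s) (w s) φ)) := by
  obtain ⟨M₁, hM₁⟩ := hun
  obtain ⟨M₂, hM₂⟩ := hwn
  -- The bounded set must contain the limits as well as the sequences.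
  set M := max (max M₁ ‖u‖) (max M₂ ‖w‖) with hM
  have hsub : Ioc 0 t ⊆ Icc 0 T := fun s hs => ⟨hs.1.le, hs.2.trans ht.2⟩
  have hint (f : ℝ → ℝ) : ∫ s in 0..t, f s = ∫ s in Ioc 0 t, f s ∂timeMeasure T := by
    rw [intervalIntegral.integral_of_le ht.1, Measure.restrict_restrict_of_subset hsub]
  simp_rw [hint]
  refine tendsto_setIntegral_of_L1 _ (hB.integrable φ (Lp.memLp u) (Lp.memLp w)).1
    (Eventually.of_forall fun n => hB.integrable φ (Lp.memLp (un n)) (Lp.memLp (wn n))) ?_ _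
  refine ENNReal.tendsto_nhds_zero.2 fun ε hε => ?_
  obtain ⟨R, δ, hδ, h⟩ := hB.exists_locSeminorm_lt hO hm hOR T φ (M := ENNReal.ofReal M)
    ENNReal.ofReal_ne_top hε
  filter_upwards [(hu R).eventually_lt_const hδ, (hw R).eventually_lt_const hδ] with n h1 h2
  exact h _ _ _ _ (Lp.aestronglyMeasurable u) (Lp.aestronglyMeasurable (un n))
    (Lp.aestronglyMeasurable w) (Lp.aestronglyMeasurable (wn n))
    (eLpNorm_Lp_le u (by simp [hM])) (eLpNorm_Lp_le (un n) (by simp [hM, hM₁ n]))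
    (eLpNorm_Lp_le w (by simp [hM])) (eLpNorm_Lp_le (wn n) (by simp [hM, hM₂ n])) h1 h2

/-- This is the uniform estimate on the diagonal `w = u`, as `H₀` carries the `L²` norm. -/
theorem IsExtensionOfb.nonlinearityIsContinuous (hO : IsOpen O) (hm : (d : ℝ) / 2 + 1 < m)
    {OR : ℕ → Set (E d)} (hOR : IsExhaustion O OR) (T : ℝ)
    {B : H₀ O →ₗ[ℝ] L2 O d →ₗ[ℝ] Hm₀ m O d →ₗ[ℝ] ℝ} (hB : IsExtensionOfb m O d B) :
    NonlinearityIsContinuous T m O OR B := by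
  intro φ _
  have hmeas (u : Lp (H₀ O) 2 (timeMeasure T)) :
      AEStronglyMeasurable (fun s => (u s : L2 O d)) (timeMeasure T) :=
    continuous_subtype_val.comp_aestronglyMeasurable (Lp.aestronglyMeasurable u)
  have hnorm (u : Lp (H₀ O) 2 (timeMeasure T)) :
      eLpNorm (fun s => (u s : L2 O d)) 2 (timeMeasure T) = eLpNorm u 2 (timeMeasure T) :=
    eLpNorm_congr_norm_ae (ae_of_all _ fun s => rfl)
  have hint (u : Lp (H₀ O) 2 (timeMeasure T)) :
      Integrable (fun s => B (u s) (u s) φ) (timeMeasure T) :=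
    hB.integrable φ (Lp.memLp u) ⟨hmeas u, (hnorm u).trans_lt (Lp.memLp u).2⟩
  refine ⟨hint, fun M u hu ε hε => ?_⟩
  -- The estimate is non-strict, so it is applied with `ε / 2` to obtain a strict inequality.
  obtain ⟨R, δ, hδ, h⟩ := hB.exists_locSeminorm_lt hO hm hOR T φ (M := ENNReal.ofReal M)
    ENNReal.ofReal_ne_top (ENNReal.ofReal_pos.2 (half_pos hε))
  refine ⟨R, δ, hδ, fun v hv hvu => ?_⟩
  have h' := h _ _ _ _ (Lp.aestronglyMeasurable u) (Lp.aestronglyMeasurable v) (hmeas u) (hmeas v)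
    (eLpNorm_Lp_le u hu) (eLpNorm_Lp_le v hv) ((hnorm u).trans_le (eLpNorm_Lp_le u hu))
    ((hnorm v).trans_le (eLpNorm_Lp_le v hv)) hvu hvu
  refine lt_of_le_of_lt ?_ (half_lt_self hε)
  simp_rw [← Real.norm_eq_abs]
  refine (integral_norm_eq_lintegral_enorm ((hint v).sub (hint u)).1).trans_le ?_
  exact ENNReal.toReal_le_of_le_ofReal (half_pos hε).le h'

end

end Convective

open Convective
theorem lemma6p1 {d : ℕ} (O : Set (E d)) (hO : IsOpen O)
    (OR : ℕ → Set (E d)) (hOR : IsExhaustion O OR) (T : ℝ) (hT : 0 < T)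
    (m : ℝ) (hm : (d : ℝ) / 2 + 1 < m) :
    -- `b` has exactly one bounded bilinear extension `B`, for every number of components `k`,
    (∀ k : ℕ, ∃! B : H₀ O →ₗ[ℝ] L2 O k →ₗ[ℝ] Hm₀ m O k →ₗ[ℝ] ℝ, IsExtensionOfb m O k B) ∧
    -- it has the convergence property,
    (∀ (k : ℕ) (B : H₀ O →ₗ[ℝ] L2 O k →ₗ[ℝ] Hm₀ m O k →ₗ[ℝ] ℝ), IsExtensionOfb m O k B →
      ∀ (u : Lp (H₀ O) 2 (timeMeasure T)) (un : ℕ → Lp (H₀ O) 2 (timeMeasure T))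
        (w : Lp (L2 O k) 2 (timeMeasure T)) (wn : ℕ → Lp (L2 O k) 2 (timeMeasure T)),
        (∃ M : ℝ, ∀ n, ‖un n‖ ≤ M) → (∃ M : ℝ, ∀ n, ‖wn n‖ ≤ M) →
        (∀ R, Tendsto (fun n => locSeminorm T (OR R)
          fun s => ((un n s - u s : H₀ O) : L2 O d)) atTop (𝓝 0)) →
        (∀ R, Tendsto (fun n => locSeminorm T (OR R) fun s => wn n s - w s) atTop (𝓝 0)) →
        ∀ φ : Hm₀ m O k,
          (∀ n, Integrable (fun s => B (un n s) (wn n s) φ) (timeMeasure T)) ∧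
          Integrable (fun s => B (u s) (w s) φ) (timeMeasure T) ∧
          ∀ t ∈ Icc 0 T, Tendsto (fun n => ∫ s in 0..t, B (un n s) (wn n s) φ) atTop
            (𝓝 (∫ s in 0..t, B (u s) (w s) φ))) ∧
    -- and, for `k = d`, `u ↦ B(u, u)` is continuous for local convergence.
    (∀ B : H₀ O →ₗ[ℝ] L2 O d →ₗ[ℝ] Hm₀ m O d →ₗ[ℝ] ℝ, IsExtensionOfb m O d B →
      NonlinearityIsContinuous T m O OR B) := by

  refine ⟨fun k => ?_, fun k B hB u un w wn hun hwn hu hw φ => ⟨fun n => ?_, ?_, fun t ht => ?_⟩,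
    fun B hB => hB.nonlinearityIsContinuous hO hm hOR T⟩
  · obtain ⟨P, D, C, hPD⟩ := exists_isSobolevEmbedding hO hm k
    exact ⟨convectiveForm D, convectiveForm_isExtensionOfb hO hPD,
      fun B hB => hB.unique hO (convectiveForm_isExtensionOfb hO hPD)⟩
  · exact hB.integrable φ (Lp.memLp (un n)) (Lp.memLp (wn n))
  · exact hB.integrable φ (Lp.memLp u) (Lp.memLp w)
  · exact hB.tendsto_integral hO hm hOR u un w wn hun hwn hu hw φ ht
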